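/- Let $d$ be a metric on $\mathbb{R}^n$ and let $B\subset\mathbb{R}^n$ be a $d$-ball of positive radius that is open and bounded in the Euclidean sense. Put $d\mu = dx/|B|$ on $B$. Let $A$ be a bounded measurable function on $B$ with values in the symmetric nonnegative semidefinite $n\times n$ matrices, and write $\|\nabla_A w\|_{L^2(B,d\mu)}=\big(\int_B \nabla w\cdot A\nabla w\,d\mu\big)^{1/2}$. Let $(W_A^{1,2})_0(B)$ be the closure of the Lipschitz functions with compact support in $B$ for the norm $\big(\int_B (|w|^2+\nabla w\cdot A\nabla w)\,d\mu\big)^{1/2}$; its elements are pairs $(w,\nabla w)$ that are limits of pairs $(w_k,\nabla w_k)$ with $w_k$ Lipschitz and compactly supported in $B$, and pairs at distance zero are identified. Let $\phi:\mathbb{R}\to[0,\infty]$ be a Young function, that is, convex, lower semicontinuous, even, with $\phi(0)=0$, and such that neither $\phi$ nor its convex conjugate vanishes identically. Suppose that $\phi(t)\ge t^2$ for all $t\ge 0$ and that, for some $N>1$, $\phi(t)\ge t^2(\ln t)^N$ for all $t\ge 1$. Suppose that the $(\phi,2)$ Orlicz–Sobolev inequality $$\|w\|_{L^\phi(B,d\mu)}\le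 C_0\,\|\nabla_A w\|_{L^2(B,d\mu)}$$ holds with a finite constant $C_0$ for all $w\in (W_A^{1,2})_0(B)$, where $\|w\|_{L^\phi(B,d\mu)}=\inf\{k>0:\int_B\phi(w/k)\,d\mu\le 1\}$. Then there is a constant $C$ such that for every $f\in L^\infty(B)$ there is a unique weak solution $u\in (W_A^{1,2})_0(B)$ of $\nabla\cdot A\nabla u=f$ in $B$, $u|_{\partial B}=0$, i.e. a unique $u\in (W_A^{1,2})_0(B)$ with $$\int_B \nabla u\cdot A\nabla\psi\,d\mu=-\int_B f\psi\,d\mu$$ for all Lipschitz $\psi$ with compact support in $B$, and it satisfies $$\|u\|_{L^\infty(B)}\le C\,\|f\|_{L^\infty(B)}.$$ -/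

import Mathlib

open MeasureTheory Filter Topology Set
open scoped NNReal ENNReal Matrix

noncomputable section

/-! ### Orlicz spaces -/

/-- The convex conjugate `sup_s (s t - θ(s))` of `θ : ℝ → [0,∞]`. When `θ 0 = 0` the supremum is
nonnegative (take `s = 0`), so truncating every term at `0` does not change it. -/
def convexConjugate (θ : ℝ → ℝ≥0∞) (t : ℝ) : ℝ≥0∞ :=
  ⨆ s : ℝ, ENNReal.ofReal (s * t) - θ s

/-- Young functions `θ : ℝ → [0,∞]`: convex, lower semicontinuous, even, vanishing at `0`, and such
that neither `θ` nor its convex conjugate is identically zero. -/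
structure IsYoungFunction (θ : ℝ → ℝ≥0∞) : Prop where
  convex : ConvexOn ℝ≥0 Set.univ θ
  lsc : LowerSemicontinuous θ
  even : ∀ t, θ (-t) = θ t
  zero : θ 0 = 0
  nontrivial : ∃ t, θ t ≠ 0
  nontrivial_conj : ∃ t, convexConjugate θ t ≠ 0

/-- The Luxemburg norm `inf {k > 0 : ∫ θ(f/k) dμ ≤ 1}`, with `inf ∅ = ∞`. -/
def luxemburgNorm {X : Type*} [MeasurableSpace X] (θ : ℝ → ℝ≥0∞) (μ : Measure X) (f : X → ℝ) :
    ℝ≥0∞ :=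
  ⨅ (k : ℝ≥0) (_ : 0 < k) (_ : ∫⁻ x, θ (f x / (k : ℝ)) ∂μ ≤ 1), (k : ℝ≥0∞)

/-! ### Balls and the normalized measure -/

/-- `B` is an open ball of positive radius for some metric on `X`. The metric is arbitrary: it is
not required to be related to any metric or topology that `X` may already carry. -/
def IsMetricBall {X : Type*} (B : Set X) : Prop :=
  ∃ (d : MetricSpace X) (x : X) (r : ℝ),
    0 < r ∧ B = @Metric.ball X d.toPseudoMetricSpace x r

/-- The normalized Lebesgue measure `dμ = dx / |B|` on `B`. -/
def normalizedMeasure {n : ℕ} (B : Set (EuclideanSpace ℝ (Fin n))) :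
    Measure (EuclideanSpace ℝ (Fin n)) :=
  (volume B)⁻¹ • volume.restrict B

/-! ### Degenerate Sobolev spaces -/

/-- The form `ξ · M η`. -/
def matForm {n : ℕ} (M : Matrix (Fin n) (Fin n) ℝ) (ξ η : EuclideanSpace ℝ (Fin n)) : ℝ :=
  ξ.ofLp ⬝ᵥ (M *ᵥ η.ofLp)

/-- `A` is a bounded measurable matrix function on `B` with (symmetric) nonnegative semidefinite
values. -/
structure IsCoefficient {n : ℕ} (B : Set (EuclideanSpace ℝ (Fin n)))
    (A : EuclideanSpace ℝ (Fin n) → Matrix (Fin n) (Fin n) ℝ) : Prop where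
  measurable : ∀ i j, AEMeasurable (fun x => A x i j) (volume.restrict B)
  bounded : ∃ Λ : ℝ, ∀ᵐ x ∂(volume.restrict B), ∀ i j, |A x i j| ≤ Λ
  posSemidef : ∀ᵐ x ∂(volume.restrict B), (A x).PosSemidef

/-- `‖∇_A u‖_{L²(B,dμ)} = (∫_B ∇u · A ∇u dμ)^{1/2}`, where `U` stands for `∇u`. -/
def gradNorm {n : ℕ} (A : EuclideanSpace ℝ (Fin n) → Matrix (Fin n) (Fin n) ℝ)
    (B : Set (EuclideanSpace ℝ (Fin n)))
    (U : EuclideanSpace ℝ (Fin n) → EuclideanSpace ℝ (Fin n)) : ℝ≥0∞ :=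
  (∫⁻ x, ENNReal.ofReal (matForm (A x) (U x) (U x)) ∂(normalizedMeasure B)) ^ (1 / 2 : ℝ)

/-- The norm `(∫_B (|u|² + ∇u · A ∇u) dμ)^{1/2}` of `W_A^{1,2}(B)`, where `U` stands for `∇u`. -/
def sobolevNorm {n : ℕ} (A : EuclideanSpace ℝ (Fin n) → Matrix (Fin n) (Fin n) ℝ)
    (B : Set (EuclideanSpace ℝ (Fin n))) (u : EuclideanSpace ℝ (Fin n) → ℝ)
    (U : EuclideanSpace ℝ (Fin n) → EuclideanSpace ℝ (Fin n)) : ℝ≥0∞ :=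
  (∫⁻ x, (ENNReal.ofReal (u x ^ 2) + ENNReal.ofReal (matForm (A x) (U x) (U x)))
    ∂(normalizedMeasure B)) ^ (1 / 2 : ℝ)

/-- Lipschitz functions with compact support in `B`. -/
structure IsLipZero {n : ℕ} (B : Set (EuclideanSpace ℝ (Fin n)))
    (w : EuclideanSpace ℝ (Fin n) → ℝ) : Prop where
  lipschitz : ∃ K : ℝ≥0, LipschitzWith K w
  compact : HasCompactSupport w
  support : tsupport w ⊆ B

/-- `u`, with gradient `U`, belongs to `(W_A^{1,2})_0(B)`, the closure of the Lipschitz functions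
with compact support in `B` for the norm of `W_A^{1,2}(B)`: the pair `(u, U)` of measurable
functions is the limit of pairs `(w, ∇w)` (`∇w` exists almost everywhere by Rademacher's theorem).
For merely measurable `A` the element of the space is the pair. Pairs at distance zero in
`sobolevNorm` represent the same element, that is, `U` matters only modulo the kernel of `A`. -/
structure MemW0 {n : ℕ} (A : EuclideanSpace ℝ (Fin n) → Matrix (Fin n) (Fin n) ℝ)
    (B : Set (EuclideanSpace ℝ (Fin n))) (u : EuclideanSpace ℝ (Fin n) → ℝ)
    (U : EuclideanSpace ℝ (Fin n) → EuclideanSpace ℝ (Fin n)) : Prop where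
  meas : AEStronglyMeasurable u (normalizedMeasure B)
  meas_grad : AEStronglyMeasurable U (normalizedMeasure B)
  approx : ∃ w : ℕ → EuclideanSpace ℝ (Fin n) → ℝ, (∀ k, IsLipZero B (w k)) ∧
    Tendsto (fun k => sobolevNorm A B (fun x => u x - w k x)
      (fun x => U x - gradient (w k) x)) atTop (𝓝 0)

/-- `u`, with gradient `U`, is a weak solution in `(W_A^{1,2})_0(B)` of `∇ · A ∇u = f` in `B`,
`u = 0` on `∂B`: one has `∫ ∇u · A ∇ψ dμ = - ∫ f ψ dμ` for every Lipschitz function `ψ` with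
compact support in `B`. -/
structure IsWeakSolution {n : ℕ} (A : EuclideanSpace ℝ (Fin n) → Matrix (Fin n) (Fin n) ℝ)
    (B : Set (EuclideanSpace ℝ (Fin n))) (f u : EuclideanSpace ℝ (Fin n) → ℝ)
    (U : EuclideanSpace ℝ (Fin n) → EuclideanSpace ℝ (Fin n)) : Prop where
  mem : MemW0 A B u U
  eq : ∀ ψ : EuclideanSpace ℝ (Fin n) → ℝ, IsLipZero B ψ →
    ∫ x, matForm (A x) (U x) (gradient ψ x) ∂(normalizedMeasure B) =
      - ∫ x, f x * ψ x ∂(normalizedMeasure B)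

end

/-! ### The form `ξ · M η` -/

section MatForm

variable {n : ℕ} {M : Matrix (Fin n) (Fin n) ℝ}

/-! Existence and uniqueness are Hilbert space arguments for the energy form. Since `φ` dominates `t
^ 2`, the Sobolev inequality contains a Poincaré inequality, so `w ↦ -∫ f w` is bounded for the
energy seminorm on compactly supported Lipschitz functions. The Riesz representation theorem in the
completion then produces Lipschitz functions `w k`, Cauchy in energy and hence in `L²`. The delicate
point is to realize the limit as a pair `(u, U)` with `U` measurable: `A` may degenerate, so the
gradients need not converge and only the fluxes `A ∇w k` do, in `L²`. One recovers `U` by inverting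
`A` on its range. This is a measurable operation, because the projection onto the range is a limit
of averages of powers of `1 - c A` (mean ergodic theorem); see
`IsCoefficientOn.exists_lintegral_limit_le`.

The sup bound is a De Giorgi iteration in which the usual power gain is only logarithmic. Testing
with `(u - l)⁺` bounds its energy by `M ∫ (u - l)⁺`, where `|f| ≤ M`. The Orlicz bound gives `∫_E
|ψ| ≤ (s μ(E) + 1 / (s (log s) ^ N)) * κ` for all `s ≥ e`, with `κ` the Sobolev bound on the norm of
`ψ`. Together, with `E = {u > l}`, they yield `∫ (u - l)⁺ ≤ (s μ(E) + 1 / (s (log s) ^ N)) ^ 2 * D`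
with `D` proportional to `M`. Taking `s` exponential in the step number makes the superlevel sets
shrink exponentially while the levels grow by increments of order `k ^ (-N)`. As `N > 1` these are
summable, so the levels stay bounded by a multiple of `M`; see `ae_le_of_superlevel_estimate`. -/

theorem matForm_add_left (M : Matrix (Fin n) (Fin n) ℝ) (ξ ξ' η : EuclideanSpace ℝ (Fin n)) :
    matForm M (ξ + ξ') η = matForm M ξ η + matForm M ξ' η := by
  simp [matForm, add_dotProduct]

theorem matForm_smul_left (M : Matrix (Fin n) (Fin n) ℝ) (c : ℝ)
    (ξ η : EuclideanSpace ℝ (Fin n)) : matForm M (c • ξ) η = c * matForm M ξ η := by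
  simp [matForm]

theorem matForm_add_right (M : Matrix (Fin n) (Fin n) ℝ) (ξ η η' : EuclideanSpace ℝ (Fin n)) :
    matForm M ξ (η + η') = matForm M ξ η + matForm M ξ η' := by
  simp [matForm, Matrix.mulVec_add, dotProduct_add]

theorem matForm_smul_right (M : Matrix (Fin n) (Fin n) ℝ) (c : ℝ)
    (ξ η : EuclideanSpace ℝ (Fin n)) : matForm M ξ (c • η) = c * matForm M ξ η := by
  simp [matForm, Matrix.mulVec_smul]

theorem matForm_neg_left (M : Matrix (Fin n) (Fin n) ℝ) (ξ η : EuclideanSpace ℝ (Fin n)) :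
    matForm M (-ξ) η = -matForm M ξ η := by
  simpa using matForm_smul_left M (-1) ξ η

theorem matForm_sub_left (M : Matrix (Fin n) (Fin n) ℝ) (ξ ξ' η : EuclideanSpace ℝ (Fin n)) :
    matForm M (ξ - ξ') η = matForm M ξ η - matForm M ξ' η := by
  rw [sub_eq_add_neg, matForm_add_left, matForm_neg_left, sub_eq_add_neg]

theorem matForm_eq_inner (M : Matrix (Fin n) (Fin n) ℝ) (ξ η : EuclideanSpace ℝ (Fin n)) :
    matForm M ξ η = inner ℝ ξ (Matrix.toEuclideanCLM (𝕜 := ℝ) M η) := by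
  simp [matForm, EuclideanSpace.inner_eq_star_dotProduct, dotProduct_comm]

theorem Matrix.PosSemidef.matForm_self_nonneg (hM : M.PosSemidef)
    (ξ : EuclideanSpace ℝ (Fin n)) : 0 ≤ matForm M ξ ξ := by
  simpa [matForm] using hM.dotProduct_mulVec_nonneg ξ.ofLp

theorem Matrix.PosSemidef.matForm_comm (hM : M.PosSemidef)
    (ξ η : EuclideanSpace ℝ (Fin n)) : matForm M ξ η = matForm M η ξ := by
  have h : Mᵀ = M := by simpa [Matrix.IsHermitian] using hM.isHermitian
  unfold matForm
  rw [dotProduct_comm, ← Matrix.vecMul_transpose, h, Matrix.dotProduct_mulVec]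

/-- The discriminant argument behind both Cauchy–Schwarz inequalities, pointwise and integrated; it
does not need the form to be definite. -/
theorem sq_le_mul_of_quadratic_nonneg {a b c : ℝ} (h : ∀ t : ℝ, 0 ≤ a * (t * t) + 2 * b * t + c) :
    b ^ 2 ≤ a * c := by
  have := discrim_le_zero h
  unfold discrim at this
  nlinarith

theorem Matrix.PosSemidef.matForm_sq_le (hM : M.PosSemidef) (ξ η : EuclideanSpace ℝ (Fin n)) :
    matForm M ξ η ^ 2 ≤ matForm M ξ ξ * matForm M η η := by
  rw [mul_comm]
  refine sq_le_mul_of_quadratic_nonneg fun t => ?_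
  have := hM.matForm_self_nonneg (ξ + t • η)
  simp only [matForm_add_left, matForm_add_right, matForm_smul_left, matForm_smul_right,
    hM.matForm_comm η ξ] at this
  linarith

theorem abs_matForm_le {Λ : ℝ} (hM : ∀ i j, |M i j| ≤ Λ) (ξ η : EuclideanSpace ℝ (Fin n)) :
    |matForm M ξ η| ≤ n ^ 2 * Λ * (‖ξ‖ * ‖η‖) := by
  have h1 : matForm M ξ η = ∑ i, ∑ j, ξ i * (M i j * η j) := by
    simp [matForm, dotProduct, Matrix.mulVec, Finset.mul_sum]
  rw [h1]
  calc |∑ i, ∑ j, ξ i * (M i j * η j)| ≤ ∑ i, ∑ j, |ξ i * (M i j * η j)| :=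
        (Finset.abs_sum_le_sum_abs _ _).trans
          (Finset.sum_le_sum fun i _ => Finset.abs_sum_le_sum_abs _ _)
    _ ≤ ∑ _i : Fin n, ∑ _j : Fin n, Λ * (‖ξ‖ * ‖η‖) := by
        refine Finset.sum_le_sum fun i _ => Finset.sum_le_sum fun j _ => ?_
        have h2 : |ξ i| ≤ ‖ξ‖ := by simpa using PiLp.norm_apply_le ξ i
        have h3 : |η j| ≤ ‖η‖ := by simpa using PiLp.norm_apply_le η j
        have hΛ : 0 ≤ Λ := (abs_nonneg _).trans (hM i j)
        rw [abs_mul, abs_mul]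
        calc |ξ i| * (|M i j| * |η j|) ≤ ‖ξ‖ * (Λ * ‖η‖) := by
              gcongr
              exact hM i j
          _ = _ := by ring
    _ = _ := by simp; ring

/-- With `ζ = M ξ`, Cauchy–Schwarz gives `‖ζ‖ ^ 4 = (ζ · M ξ) ^ 2 ≤ (ζ · M ζ)(ξ · M ξ)`; bound `ζ ·
M ζ` by `‖ζ‖ ^ 2` and cancel. This is how energy controls the flux. -/
theorem Matrix.PosSemidef.norm_sq_le (hM : M.PosSemidef) {Λ : ℝ} (hΛ : ∀ i j, |M i j| ≤ Λ)
    (ξ : EuclideanSpace ℝ (Fin n)) :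
    ‖Matrix.toEuclideanCLM (𝕜 := ℝ) M ξ‖ ^ 2 ≤ n ^ 2 * Λ * matForm M ξ ξ := by
  set ζ := Matrix.toEuclideanCLM (𝕜 := ℝ) M ξ with hζ
  have h1 : matForm M ζ ξ = ‖ζ‖ ^ 2 := by rw [matForm_eq_inner, ← hζ, real_inner_self_eq_norm_sq]
  have h2 := hM.matForm_sq_le ζ ξ
  have h3 := (le_abs_self _).trans (abs_matForm_le hΛ ζ ζ)
  have h4 := hM.matForm_self_nonneg ξ
  rw [h1] at h2
  rcases (norm_nonneg ζ).eq_or_lt with h | h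
  · have h5 : 0 ≤ (n : ℝ) ^ 2 * Λ := by
      -- In dimension zero `Λ` may be negative, but the factor `n ^ 2` vanishes.
      rcases n with _ | n
      · simp
      · have := (abs_nonneg _).trans (hΛ 0 0)
        positivity
    rw [← h]
    simpa using mul_nonneg h5 h4
  · have h5 : (‖ζ‖ ^ 2) ^ 2 ≤ (n ^ 2 * Λ * (‖ζ‖ * ‖ζ‖)) * matForm M ξ ξ :=
      h2.trans (by gcongr)
    have h6 : 0 < ‖ζ‖ ^ 2 := by positivity
    refine le_of_mul_le_mul_left ?_ h6
    nlinarith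

end MatForm

/-! ### Vector fields of finite energy -/

/-- The hypotheses of `IsCoefficient`, relative to an arbitrary measure. -/
structure IsCoefficientOn {n : ℕ} (μ : Measure (EuclideanSpace ℝ (Fin n)))
    (A : EuclideanSpace ℝ (Fin n) → Matrix (Fin n) (Fin n) ℝ) : Prop where
  measurable : ∀ i j, AEMeasurable (fun x => A x i j) μ
  bounded : ∃ Λ : ℝ, ∀ᵐ x ∂μ, ∀ i j, |A x i j| ≤ Λ
  posSemidef : ∀ᵐ x ∂μ, (A x).PosSemidef

/-- The bilinear form `∫ X · A Y dμ`. -/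
noncomputable def energy {n : ℕ} (μ : Measure (EuclideanSpace ℝ (Fin n)))
    (A : EuclideanSpace ℝ (Fin n) → Matrix (Fin n) (Fin n) ℝ)
    (X Y : EuclideanSpace ℝ (Fin n) → EuclideanSpace ℝ (Fin n)) : ℝ :=
  ∫ x, matForm (A x) (X x) (Y x) ∂μ

/-- Measurable vector fields `X` with `X · A X` integrable. -/
structure FiniteEnergy {n : ℕ} (μ : Measure (EuclideanSpace ℝ (Fin n)))
    (A : EuclideanSpace ℝ (Fin n) → Matrix (Fin n) (Fin n) ℝ)
    (X : EuclideanSpace ℝ (Fin n) → EuclideanSpace ℝ (Fin n)) : Prop where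
  meas : AEStronglyMeasurable X μ
  integrable_self : Integrable (fun x => matForm (A x) (X x) (X x)) μ

section Energy

variable {n : ℕ} {μ : Measure (EuclideanSpace ℝ (Fin n))}
  {A : EuclideanSpace ℝ (Fin n) → Matrix (Fin n) (Fin n) ℝ}
  {X Y Z : EuclideanSpace ℝ (Fin n) → EuclideanSpace ℝ (Fin n)}

theorem aestronglyMeasurable_eval (hX : AEStronglyMeasurable X μ) (i : Fin n) :
    AEMeasurable (fun x => X x i) μ :=
  (EuclideanSpace.proj (𝕜 := ℝ) i).continuous.measurable.comp_aemeasurable hX.aemeasurable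

theorem IsCoefficientOn.aestronglyMeasurable_toEuclideanCLM (hA : IsCoefficientOn μ A)
    (hX : AEStronglyMeasurable X μ) :
    AEStronglyMeasurable (fun x => Matrix.toEuclideanCLM (𝕜 := ℝ) (A x) (X x)) μ := by
  have h1 : AEMeasurable (fun x => A x *ᵥ (X x).ofLp) μ := by
    refine aemeasurable_pi_lambda _ fun i => ?_
    simp only [Matrix.mulVec, dotProduct]
    exact Finset.aemeasurable_fun_sum _ fun j _ =>
      (hA.measurable i j).mul (aestronglyMeasurable_eval hX j)
  have h2 := (PiLp.continuous_toLp 2 (fun _ : Fin n => ℝ)).measurable.comp_aemeasurable h1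
  exact h2.aestronglyMeasurable

theorem IsCoefficientOn.aestronglyMeasurable_matForm (hA : IsCoefficientOn μ A)
    (hX : AEStronglyMeasurable X μ) (hY : AEStronglyMeasurable Y μ) :
    AEStronglyMeasurable (fun x => matForm (A x) (X x) (Y x)) μ := by
  simp only [matForm_eq_inner]
  exact hX.inner (hA.aestronglyMeasurable_toEuclideanCLM hY)

theorem FiniteEnergy.integrable (hA : IsCoefficientOn μ A) (hX : FiniteEnergy μ A X)
    (hY : FiniteEnergy μ A Y) : Integrable (fun x => matForm (A x) (X x) (Y x)) μ := by
  refine (hX.integrable_self.add hY.integrable_self).mono'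
    (hA.aestronglyMeasurable_matForm hX.meas hY.meas) ?_
  filter_upwards [hA.posSemidef] with x hx
  have h1 := hx.matForm_self_nonneg (X x)
  have h2 := hx.matForm_self_nonneg (Y x)
  have h3 := hx.matForm_sq_le (X x) (Y x)
  rw [Real.norm_eq_abs]
  refine abs_le_of_sq_le_sq (h3.trans ?_) (by simp; positivity)
  simp only [Pi.add_apply]
  nlinarith

theorem FiniteEnergy.add (hA : IsCoefficientOn μ A) (hX : FiniteEnergy μ A X)
    (hY : FiniteEnergy μ A Y) : FiniteEnergy μ A (fun x => X x + Y x) where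
  meas := hX.meas.add hY.meas
  integrable_self := by
    simp only [matForm_add_left, matForm_add_right]
    exact (hX.integrable_self.add (hY.integrable hA hX)).add
      ((hX.integrable hA hY).add hY.integrable_self)

theorem FiniteEnergy.const_smul (hX : FiniteEnergy μ A X) (c : ℝ) :
    FiniteEnergy μ A (fun x => c • X x) where
  meas := hX.meas.const_smul c
  integrable_self := by
    simp only [matForm_smul_left, matForm_smul_right]
    exact (hX.integrable_self.const_mul c).const_mul c

theorem FiniteEnergy.sub (hA : IsCoefficientOn μ A) (hX : FiniteEnergy μ A X)
    (hY : FiniteEnergy μ A Y) : FiniteEnergy μ A (fun x => X x - Y x) := by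
  simpa [sub_eq_add_neg] using hX.add hA (hY.const_smul (-1))

theorem FiniteEnergy.congr (hX : FiniteEnergy μ A X) (h : X =ᵐ[μ] Y) : FiniteEnergy μ A Y where
  meas := hX.meas.congr h
  integrable_self := hX.integrable_self.congr (by filter_upwards [h] with x hx; rw [hx])

theorem energy_congr {X' Y' : EuclideanSpace ℝ (Fin n) → EuclideanSpace ℝ (Fin n)}
    (hX : X =ᵐ[μ] X') (hY : Y =ᵐ[μ] Y') : energy μ A X Y = energy μ A X' Y' :=
  integral_congr_ae (by filter_upwards [hX, hY] with x h1 h2; rw [h1, h2])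

theorem energy_add_left (hA : IsCoefficientOn μ A) (hX : FiniteEnergy μ A X)
    (hY : FiniteEnergy μ A Y) (hZ : FiniteEnergy μ A Z) :
    energy μ A (fun x => X x + Y x) Z = energy μ A X Z + energy μ A Y Z := by
  simp only [energy, matForm_add_left]
  exact integral_add (hX.integrable hA hZ) (hY.integrable hA hZ)

theorem energy_sub_left (hA : IsCoefficientOn μ A) (hX : FiniteEnergy μ A X)
    (hY : FiniteEnergy μ A Y) (hZ : FiniteEnergy μ A Z) :
    energy μ A (fun x => X x - Y x) Z = energy μ A X Z - energy μ A Y Z := by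
  simp only [energy, matForm_sub_left]
  exact integral_sub (hX.integrable hA hZ) (hY.integrable hA hZ)

theorem energy_smul_left (c : ℝ) :
    energy μ A (fun x => c • X x) Y = c * energy μ A X Y := by
  simp only [energy, matForm_smul_left]
  exact integral_const_mul _ _

theorem energy_comm (hA : IsCoefficientOn μ A) : energy μ A X Y = energy μ A Y X :=
  integral_congr_ae (by filter_upwards [hA.posSemidef] with x hx; exact hx.matForm_comm _ _)

theorem energy_self_nonneg (hA : IsCoefficientOn μ A) : 0 ≤ energy μ A X X :=
  integral_nonneg_of_ae (by
    filter_upwards [hA.posSemidef] with x hx; exact hx.matForm_self_nonneg _)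

theorem energy_sq_le (hA : IsCoefficientOn μ A) (hX : FiniteEnergy μ A X)
    (hY : FiniteEnergy μ A Y) :
    energy μ A X Y ^ 2 ≤ energy μ A X X * energy μ A Y Y := by
  rw [mul_comm]
  refine sq_le_mul_of_quadratic_nonneg fun t => ?_
  have h := energy_self_nonneg (X := fun x => X x + t • Y x) hA
  have hY' := hY.const_smul t
  have hS := hX.add hA hY'
  rw [energy_add_left hA hX hY' hS, energy_comm hA, energy_add_left hA hX hY' hX,
    energy_comm hA (Y := fun x => X x + t • Y x), energy_add_left hA hX hY' hY',
    energy_comm hA (X := X) (Y := fun x => t • Y x)] at h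
  simp only [energy_smul_left] at h
  rw [energy_comm hA (X := Y) (Y := fun x => t • Y x), energy_smul_left,
    energy_comm hA (X := Y) (Y := X)] at h
  linarith

theorem abs_energy_le (hA : IsCoefficientOn μ A) (hX : FiniteEnergy μ A X)
    (hY : FiniteEnergy μ A Y) :
    |energy μ A X Y| ≤ √(energy μ A X X) * √(energy μ A Y Y) := by
  rw [← Real.sqrt_mul (energy_self_nonneg hA)]
  exact Real.abs_le_sqrt (energy_sq_le hA hX hY)

theorem energy_add_self_le (hA : IsCoefficientOn μ A) (hX : FiniteEnergy μ A X)
    (hY : FiniteEnergy μ A Y) :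
    energy μ A (fun x => X x + Y x) (fun x => X x + Y x) ≤
      2 * energy μ A X X + 2 * energy μ A Y Y := by
  have h := energy_self_nonneg (X := fun x => X x - Y x) hA
  have hS := hX.add hA hY
  have hD := hX.sub hA hY
  rw [energy_sub_left hA hX hY hD, energy_comm hA, energy_sub_left hA hX hY hX,
    energy_comm hA (X := Y) (Y := fun x => X x - Y x), energy_sub_left hA hX hY hY,
    energy_comm hA (X := Y) (Y := X)] at h
  rw [energy_add_left hA hX hY hS, energy_comm hA, energy_add_left hA hX hY hX,
    energy_comm hA (X := Y) (Y := fun x => X x + Y x), energy_add_left hA hX hY hY,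
    energy_comm hA (X := Y) (Y := X)]
  linarith

theorem lintegral_matForm_eq (hA : IsCoefficientOn μ A) (hX : FiniteEnergy μ A X) :
    ∫⁻ x, ENNReal.ofReal (matForm (A x) (X x) (X x)) ∂μ = ENNReal.ofReal (energy μ A X X) :=
  (ofReal_integral_eq_lintegral_ofReal hX.integrable_self (by
    filter_upwards [hA.posSemidef] with x hx; exact hx.matForm_self_nonneg _)).symm

theorem FiniteEnergy.of_lintegral (hA : IsCoefficientOn μ A) (hX : AEStronglyMeasurable X μ)
    (h : ∫⁻ x, ENNReal.ofReal (matForm (A x) (X x) (X x)) ∂μ ≠ ∞) : FiniteEnergy μ A X := by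
  refine ⟨hX, ?_⟩
  refine (lintegral_ofReal_ne_top_iff_integrable (hA.aestronglyMeasurable_matForm hX hX) ?_).1 h
  filter_upwards [hA.posSemidef] with x hx
  exact hx.matForm_self_nonneg _

end Energy

/-! ### Riesz representation by approximating sequences -/

/-- The functional extends to the Hilbert completion and is represented there by a vector `h`;
choose `w k` within `2 ^ (-k) / 2` of `h`. Since `h` is not a function, the conclusion keeps only
the approximating sequence. -/
theorem exists_seq_tendsto_of_abs_le {V : Type*} [AddCommGroup V] [Module ℝ V]
    (c : PreInnerProductSpace.Core ℝ V) (ℓ : V →ₗ[ℝ] ℝ) (C : ℝ)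
    (hℓ : ∀ v, |ℓ v| ≤ C * √(c.inner v v)) :
    ∃ w : ℕ → V,
      (∀ N j k, N ≤ j → N ≤ k → c.inner (w j - w k) (w j - w k) ≤ ((1 / 2 : ℝ) ^ N) ^ 2) ∧
      ∀ v, Tendsto (fun k => c.inner (w k) v) atTop (𝓝 (ℓ v)) := by
  let _ : SeminormedAddCommGroup V := InnerProductSpace.Core.toSeminormedAddCommGroup (c := c)
  let _ : InnerProductSpace ℝ V := InnerProductSpace.ofCore c
  have hnorm : ∀ v : V, c.inner v v = ‖v‖ ^ 2 := fun v => real_inner_self_eq_norm_sq v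
  let L : V →L[ℝ] ℝ := ℓ.mkContinuous C fun v => by
    have := hℓ v
    rwa [hnorm, Real.sqrt_sq (norm_nonneg _)] at this
  let ι : V →L[ℝ] UniformSpace.Completion V := UniformSpace.Completion.toComplL
  have hι : DenseRange ι := UniformSpace.Completion.denseRange_coe
  have hιu : IsUniformInducing ι := UniformSpace.Completion.isUniformInducing_coe V
  let h := (InnerProductSpace.toDual ℝ (UniformSpace.Completion V)).symm (L.extend ι)
  have hw : ∀ k : ℕ, ∃ w : V, ‖h - ι w‖ < (1 / 2 : ℝ) ^ k / 2 := fun k => by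
    obtain ⟨w, hw⟩ := hι.exists_dist_lt h (ε := (1 / 2 : ℝ) ^ k / 2) (by positivity)
    exact ⟨w, by rwa [← dist_eq_norm]⟩
  choose w hw using hw
  refine ⟨w, fun N j k hj hk => ?_, fun v => ?_⟩
  · rw [hnorm]
    have h1 : ∀ j, N ≤ j → ‖h - ι (w j)‖ ≤ (1 / 2 : ℝ) ^ N / 2 := fun j hj =>
      (hw j).le.trans (by
        have := pow_le_pow_of_le_one (by norm_num : (0 : ℝ) ≤ 1 / 2) (by norm_num) hj
        linarith)
    have h2 : ‖ι (w j - w k)‖ ≤ (1 / 2 : ℝ) ^ N := by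
      have h3 : ι (w j - w k) = (h - ι (w k)) - (h - ι (w j)) := by rw [map_sub]; abel
      rw [h3]
      have := norm_sub_le (h - ι (w k)) (h - ι (w j))
      linarith [h1 j hj, h1 k hk]
    have h4 : ‖ι (w j - w k)‖ = ‖w j - w k‖ := UniformSpace.Completion.norm_coe _
    rw [h4] at h2
    gcongr
  · have h1 : Tendsto (fun k => ι (w k)) atTop (𝓝 h) := by
      rw [tendsto_iff_norm_sub_tendsto_zero]
      refine squeeze_zero (fun _ => norm_nonneg _) (g := fun k => (1 / 2 : ℝ) ^ k / 2)
        (fun k => ?_) ?_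
      · rw [norm_sub_rev]
        exact (hw k).le
      · simpa using (tendsto_pow_atTop_nhds_zero_of_lt_one (by norm_num : (0 : ℝ) ≤ 1 / 2)
          (by norm_num)).div_const 2
    have h2 := h1.inner (𝕜 := ℝ) (tendsto_const_nhds (x := ι v))
    have h3 : inner ℝ h (ι v) = ℓ v := by
      have := InnerProductSpace.toDual_symm_apply (𝕜 := ℝ) (x := ι v) (y := L.extend ι)
      rw [this, ContinuousLinearMap.extend_eq _ hι hιu]
      rfl
    rw [h3] at h2
    refine h2.congr fun k => ?_
    exact UniformSpace.Completion.inner_coe _ _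

/-! ### Consequences of a bound on the Luxemburg norm -/

section Luxemburg

variable {α : Type*} [MeasurableSpace α] {μ : Measure α} {φ : ℝ → ℝ≥0∞} {ψ : α → ℝ} {κ : ℝ}

theorem exists_lintegral_le_one_of_luxemburgNorm_le (h : luxemburgNorm φ μ ψ ≤ ENNReal.ofReal κ)
    (hκ : 0 ≤ κ) {κ' : ℝ} (hκ' : κ < κ') :
    ∃ k : ℝ, 0 < k ∧ k < κ' ∧ ∫⁻ x, φ (ψ x / k) ∂μ ≤ 1 := by
  have h1 : luxemburgNorm φ μ ψ < ENNReal.ofReal κ' :=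
    h.trans_lt ((ENNReal.ofReal_lt_ofReal_iff (hκ.trans_lt hκ')).2 hκ')
  simp only [luxemburgNorm, iInf_lt_iff] at h1
  obtain ⟨k, hk0, hk1, hk2⟩ := h1
  refine ⟨k, hk0, ?_, hk1⟩
  have := (ENNReal.lt_ofReal_iff_toReal_lt ENNReal.coe_ne_top).1 hk2
  simpa using this

/-- Put `t = |ψ| / k` with `∫ φ(ψ / k) ≤ 1`. Where `t ≤ s`, use `|ψ| ≤ s k`. Where `t > s`,
monotonicity of the logarithm gives `t * (s (log s) ^ N) ≤ t ^ 2 (log t) ^ N ≤ φ(t)`, so `|ψ|` is at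
most `k / (s (log s) ^ N)` times `φ(ψ / k)`. The parameter `s` stays free for the iteration. -/
theorem setIntegral_abs_le_of_luxemburgNorm_le [IsFiniteMeasure μ] {N : ℝ}
    (heven : ∀ t, φ (-t) = φ t)
    (hlog : ∀ t : ℝ, 1 ≤ t → ENNReal.ofReal (t ^ 2 * Real.log t ^ N) ≤ φ t) (hN : 0 ≤ N)
    (hψ : Integrable ψ μ) (hκ : 0 ≤ κ) (h : luxemburgNorm φ μ ψ ≤ ENNReal.ofReal κ)
    {s : ℝ} (hs : Real.exp 1 ≤ s) (E : Set α) :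
    ∫ x in E, |ψ x| ∂μ ≤ (s * μ.real E + 1 / (s * Real.log s ^ N)) * κ := by
  have hs1 : 1 < s := lt_of_lt_of_le (by simp) hs
  have hs0 : 0 < s := by linarith
  have hlogs : 0 < Real.log s := Real.log_pos hs1
  set c := s * Real.log s ^ N with hc
  have hc0 : 0 < c := by positivity
  have habs : ∀ t, φ |t| = φ t := fun t => by
    rcases abs_choice t with h | h <;> rw [h]
    exact heven t
  -- The infimum defining the norm need not be attained, so the bound is proved for each `κ' > κ`,
  -- and then `κ'` decreases to `κ`.
  suffices H : ∀ κ', κ < κ' → ∫ x in E, |ψ x| ∂μ ≤ (s * μ.real E + 1 / c) * κ' by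
    have hlim : Tendsto (fun κ' => (s * μ.real E + 1 / c) * κ') (𝓝[>] κ)
        (𝓝 ((s * μ.real E + 1 / c) * κ)) :=
      ((continuous_const_mul _).tendsto κ).mono_left nhdsWithin_le_nhds
    exact ge_of_tendsto hlim (by filter_upwards [self_mem_nhdsWithin] with κ' hκ' using H κ' hκ')
  intro κ' hκ'
  obtain ⟨k, hk0, hk1, hk2⟩ := exists_lintegral_le_one_of_luxemburgNorm_le h hκ hκ'
  have hpt : ∀ x, ENNReal.ofReal |ψ x| ≤
      ENNReal.ofReal (s * k) + ENNReal.ofReal (k / c) * φ (ψ x / k) := fun x => by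
    set t := |ψ x| / k with ht
    have ht0 : 0 ≤ t := by positivity
    have hψt : |ψ x| = k * t := by rw [ht]; field_simp
    rcases le_or_gt t s with hts | hts
    · refine le_add_right (ENNReal.ofReal_le_ofReal ?_)
      rw [hψt, mul_comm]
      gcongr
    · refine le_add_left ?_
      have h1 : φ (ψ x / k) = φ t := by rw [← habs, abs_div, abs_of_pos hk0]
      rw [h1]
      refine le_trans ?_ (mul_le_mul_right (hlog t (hs1.trans hts).le) _)
      rw [← ENNReal.ofReal_mul (by positivity)]
      refine ENNReal.ofReal_le_ofReal ?_
      have h2 : c ≤ t * Real.log t ^ N := by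
        rw [hc]
        have : Real.log s ≤ Real.log t := Real.log_le_log hs0 hts.le
        gcongr
      rw [hψt]
      calc k * t = k / c * (t * c) := by field_simp
        _ ≤ k / c * (t * (t * Real.log t ^ N)) := by gcongr
        _ = _ := by ring
  have h1 : ∫⁻ x in E, ENNReal.ofReal |ψ x| ∂μ ≤
      ENNReal.ofReal ((s * μ.real E + 1 / c) * k) := by
    calc ∫⁻ x in E, ENNReal.ofReal |ψ x| ∂μ
        ≤ ∫⁻ x in E, (ENNReal.ofReal (s * k) + ENNReal.ofReal (k / c) * φ (ψ x / k)) ∂μ :=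
          lintegral_mono hpt
      _ = ENNReal.ofReal (s * k) * μ E +
          ENNReal.ofReal (k / c) * ∫⁻ x in E, φ (ψ x / k) ∂μ := by
          rw [lintegral_add_left measurable_const, lintegral_const_mul' _ _ ENNReal.ofReal_ne_top]
          simp
      _ ≤ ENNReal.ofReal (s * k) * μ E + ENNReal.ofReal (k / c) * 1 := by
          gcongr
          exact (setLIntegral_le_lintegral _ _).trans hk2
      _ = _ := by
          rw [← ofReal_measureReal (measure_ne_top _ _), mul_one,
            ← ENNReal.ofReal_mul (by positivity),
            ← ENNReal.ofReal_add (by positivity) (by positivity)]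
          congr 1
          ring
  rw [← ofReal_integral_eq_lintegral_ofReal hψ.abs.integrableOn
    (ae_of_all _ fun _ => abs_nonneg _), ENNReal.ofReal_le_ofReal_iff (by positivity)] at h1
  exact h1.trans (by gcongr)

/-- Since `φ` dominates the square, the Luxemburg norm dominates the `L²` norm; with the Sobolev
inequality this becomes the Poincaré inequality. -/
theorem lintegral_sq_le_of_luxemburgNorm_le (heven : ∀ t, φ (-t) = φ t)
    (hsq : ∀ t : ℝ, 0 ≤ t → ENNReal.ofReal (t ^ 2) ≤ φ t)
    (hκ : 0 ≤ κ) (h : luxemburgNorm φ μ ψ ≤ ENNReal.ofReal κ) :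
    ∫⁻ x, ENNReal.ofReal (ψ x ^ 2) ∂μ ≤ ENNReal.ofReal (κ ^ 2) := by
  have habs : ∀ t, ENNReal.ofReal (t ^ 2) ≤ φ t := fun t => by
    have := hsq |t| (abs_nonneg t)
    rw [sq_abs] at this
    rcases abs_choice t with h | h <;> rw [h] at this
    · exact this
    · rwa [heven] at this
  have hlim : Tendsto (fun κ' => ENNReal.ofReal (κ' ^ 2)) (𝓝[>] κ) (𝓝 (ENNReal.ofReal (κ ^ 2))) :=
    ((ENNReal.continuous_ofReal.comp (continuous_pow 2)).tendsto κ).mono_left nhdsWithin_le_nhds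
  refine ge_of_tendsto hlim ?_
  filter_upwards [self_mem_nhdsWithin] with κ' hκ'
  obtain ⟨k, hk0, hk1, hk2⟩ := exists_lintegral_le_one_of_luxemburgNorm_le h hκ hκ'
  calc ∫⁻ x, ENNReal.ofReal (ψ x ^ 2) ∂μ
      ≤ ∫⁻ x, ENNReal.ofReal (k ^ 2) * φ (ψ x / k) ∂μ := by
        refine lintegral_mono fun x => ?_
        refine le_trans ?_ (mul_le_mul_right (habs (ψ x / k)) _)
        rw [← ENNReal.ofReal_mul (by positivity)]
        refine ENNReal.ofReal_le_ofReal (le_of_eq ?_)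
        field_simp
    _ = ENNReal.ofReal (k ^ 2) * ∫⁻ x, φ (ψ x / k) ∂μ :=
        lintegral_const_mul' _ _ ENNReal.ofReal_ne_top
    _ ≤ ENNReal.ofReal (k ^ 2) * 1 := by gcongr
    _ ≤ ENNReal.ofReal (κ' ^ 2) := by
        rw [mul_one]
        gcongr

end Luxemburg

/-! ### De Giorgi iteration with a logarithmic gain -/

/-- The increments of the levels in the iteration. -/
noncomputable def levelIncrement (N : ℝ) (k : ℕ) : ℝ :=
  4 * Real.exp 1 ^ 2 * ((k : ℝ) + 2) ^ N / (((k : ℝ) + 1) ^ N) ^ 2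

/-- The supremum of the levels in the iteration. -/
noncomputable def levelBound (N : ℝ) : ℝ :=
  16 * Real.exp 1 ^ 2 + ∑' k, levelIncrement N k

theorem levelIncrement_pos (N : ℝ) (k : ℕ) : 0 < levelIncrement N k := by
  unfold levelIncrement
  positivity

theorem levelBound_nonneg (N : ℝ) : 0 ≤ levelBound N :=
  add_nonneg (by positivity) (tsum_nonneg fun k => (levelIncrement_pos N k).le)

/-- As `k + 2 ≤ 2 (k + 1)`, the increments are at most a constant times `(k + 1) ^ (-N)`. The strict
inequality `N > 1` is needed here. -/
theorem summable_levelIncrement {N : ℝ} (hN : 1 < N) : Summable (levelIncrement N) := by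
  have h1 : Summable fun k : ℕ => 4 * Real.exp 1 ^ 2 * 2 ^ N * (1 / ((k + 1 : ℕ) : ℝ) ^ N) :=
    ((summable_nat_add_iff 1).2 (Real.summable_one_div_nat_rpow.2 hN)).mul_left _
  refine Summable.of_nonneg_of_le (fun k => (levelIncrement_pos N k).le) (fun k => ?_) h1
  have hk : (0 : ℝ) < (k : ℝ) + 1 := by positivity
  have h2 : ((k : ℝ) + 2) ^ N ≤ 2 ^ N * ((k : ℝ) + 1) ^ N := by
    rw [← Real.mul_rpow (by norm_num) hk.le]
    gcongr
    linarith
  have h3 : 0 < ((k : ℝ) + 1) ^ N := by positivity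
  unfold levelIncrement
  push_cast
  rw [div_le_iff₀ (by positivity)]
  calc 4 * Real.exp 1 ^ 2 * ((k : ℝ) + 2) ^ N
      ≤ 4 * Real.exp 1 ^ 2 * (2 ^ N * ((k : ℝ) + 1) ^ N) := by gcongr
    _ = _ := by field_simp

theorem measureReal_superlevel_mul_le {α : Type*} [MeasurableSpace α] {μ : Measure α}
    [IsFiniteMeasure μ] {u : α → ℝ} (hu : Integrable u μ) (l : ℝ) (δ : ℝ) :
    δ * μ.real {x | l + δ < u x} ≤ ∫ x, max (u x - l) 0 ∂μ := by
  have hint : Integrable (fun x => max (u x - l) 0) μ := (hu.sub (integrable_const l)).pos_part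
  rcases le_or_gt δ 0 with h | h
  · exact (mul_nonpos_of_nonpos_of_nonneg h measureReal_nonneg).trans
      (integral_nonneg fun x => le_max_right _ _)
  · refine le_trans ?_ (mul_meas_ge_le_integral_of_nonneg
      (ae_of_all _ fun x => le_max_right _ _) hint δ)
    gcongr
    · exact measure_ne_top _ _
    · rename_i x
      intro hx
      exact le_max_of_le_left (by linarith)

/-- Chebyshev's inequality between consecutive levels turns the integral estimate into a recursion
for `μ {u > l k}`. The bound on these measures tends to zero while the levels converge. -/
theorem ae_le_of_superlevel_estimate {α : Type*} [MeasurableSpace α] {μ : Measure α}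
    [IsProbabilityMeasure μ] {u : α → ℝ} (hu : Integrable u μ) {N D : ℝ} (hN : 1 < N) (hD : 0 < D)
    (h : ∀ l, 0 ≤ l → ∀ s, Real.exp 1 ≤ s → ∫ x, max (u x - l) 0 ∂μ ≤
      (s * μ.real {x | l < u x} + 1 / (s * Real.log s ^ N)) ^ 2 * D) :
    ∀ᵐ x ∂μ, u x ≤ levelBound N * D := by
  set e := Real.exp 1 with he
  have he0 : 0 < e := Real.exp_pos 1
  -- The first level comes from the estimate at `l = 0`, `s = e`: its bracket is at most `e + 1 / e
  -- ≤ 4`, so `∫ u⁺ ≤ 16 D`, and Chebyshev at height `16 e ^ 2 D` gives measure at most `e ^ (-2)`.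
  set l : ℕ → ℝ := fun k => (16 * e ^ 2 + ∑ j ∈ Finset.range k, levelIncrement N j) * D with hl
  have hl0 : ∀ k, 0 ≤ l k := fun k =>
    mul_nonneg (add_nonneg (by positivity)
      (Finset.sum_nonneg fun j _ => (levelIncrement_pos N j).le)) hD.le
  have hstep : ∀ k, l (k + 1) = l k + levelIncrement N k * D := fun k => by
    simp only [hl, Finset.sum_range_succ]
    ring
  have key : ∀ k : ℕ, μ.real {x | l k < u x} ≤ 1 / ((e ^ (k + 1)) ^ 2 * ((k : ℝ) + 1) ^ N) := by
    intro k
    induction k with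
    | zero =>
      have h1 := h 0 le_rfl e le_rfl
      have h2 := measureReal_superlevel_mul_le hu 0 (16 * e ^ 2 * D)
      have h3 : e * μ.real {x | 0 < u x} + 1 / (e * Real.log e ^ N) ≤ 4 := by
        have h4 : e ≤ 2.72 := Real.exp_one_lt_d9.le.trans (by norm_num)
        have h5 : 1 ≤ e := by linarith [Real.add_one_le_exp (1 : ℝ)]
        have h6 : μ.real {x | 0 < u x} ≤ 1 := measureReal_le_one
        have h7 : 1 / e ≤ 1 := by rw [div_le_one he0]; exact h5
        have h8 : Real.log e = 1 := Real.log_exp 1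
        rw [h8, Real.one_rpow, mul_one]
        nlinarith
      have h4 : (e * μ.real {x | 0 < u x} + 1 / (e * Real.log e ^ N)) ^ 2 ≤ 4 ^ 2 := by
        have : 0 ≤ Real.log e := by rw [he, Real.log_exp]; norm_num
        gcongr
      have h5 : 16 * e ^ 2 * D * μ.real {x | 0 + 16 * e ^ 2 * D < u x} ≤ 16 * D :=
        h2.trans (h1.trans (by nlinarith))
      have h6 : l 0 = 0 + 16 * e ^ 2 * D := by simp [hl]
      rw [h6, le_div_iff₀ (by positivity)]
      simp only [zero_add, pow_one, Nat.cast_zero, Real.one_rpow, mul_one] at h5 ⊢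
      have h7 : 0 < 16 * D := by positivity
      refine le_of_mul_le_mul_left ?_ h7
      linarith
    | succ k ih =>
      set p := ((k : ℝ) + 1) ^ N with hp
      set q := ((k : ℝ) + 2) ^ N with hq
      have hp0 : 0 < p := by positivity
      have hq0 : 0 < q := by positivity
      -- This `s` balances the two terms: under the induction hypothesis both are at most `1 / (s
      -- p)`.
      set s := e ^ (k + 1) with hs
      have hs0 : 0 < s := by positivity
      have hes : e ≤ s := by
        have h5 : 1 ≤ e := by linarith [Real.add_one_le_exp (1 : ℝ)]
        exact le_self_pow₀ h5 (Nat.succ_ne_zero k)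
      have hlog : Real.log s = (k : ℝ) + 1 := by
        rw [hs, Real.log_pow, he, Real.log_exp]
        push_cast
        ring
      have h1 := h (l k) (hl0 k) s hes
      rw [hlog] at h1
      have h2 : s * μ.real {x | l k < u x} + 1 / (s * p) ≤ 2 / (s * p) := by
        have : s * μ.real {x | l k < u x} ≤ s * (1 / (s ^ 2 * p)) := by gcongr
        have h3 : s * (1 / (s ^ 2 * p)) = 1 / (s * p) := by field_simp
        rw [h3] at this
        have h4 : 2 / (s * p) = 1 / (s * p) + 1 / (s * p) := by ring
        linarith
      have h3 : (s * μ.real {x | l k < u x} + 1 / (s * p)) ^ 2 ≤ (2 / (s * p)) ^ 2 := by gcongr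
      have h4 := measureReal_superlevel_mul_le hu (l k) (levelIncrement N k * D)
      rw [← hstep] at h4
      have h5 : levelIncrement N k * D * μ.real {x | l (k + 1) < u x} ≤ (2 / (s * p)) ^ 2 * D :=
        h4.trans (h1.trans (by gcongr))
      have h6 : levelIncrement N k = 4 * e ^ 2 * q / p ^ 2 := rfl
      have h7 : 0 < levelIncrement N k * D := mul_pos (levelIncrement_pos N k) hD
      have h8 : (((k + 1 : ℕ) : ℝ) + 1) ^ N = q := by
        rw [hq]
        push_cast
        congr 1
        ring
      rw [h8, pow_succ e (k + 1), ← hs]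
      -- The increment `4 e ^ 2 q / p ^ 2` is what turns `(2 / (s p)) ^ 2` into exactly the bound
      -- wanted at step `k + 1`.
      refine le_of_mul_le_mul_left (h5.trans (le_of_eq ?_)) h7
      rw [h6]
      field_simp
      norm_num
  have hle : ∀ k, l k ≤ levelBound N * D := fun k => by
    simp only [hl, levelBound]
    gcongr
    exact (summable_levelIncrement hN).sum_le_tsum _ fun j _ => (levelIncrement_pos N j).le
  have hzero : μ.real {x | levelBound N * D < u x} ≤ 0 := by
    have hlim : Tendsto (fun k : ℕ => 1 / ((k : ℝ) + 1)) atTop (𝓝 0) :=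
      tendsto_one_div_add_atTop_nhds_zero_nat
    refine ge_of_tendsto' hlim fun k => ?_
    have h1 : μ.real {x | levelBound N * D < u x} ≤ μ.real {x | l k < u x} :=
      measureReal_mono fun x hx => (hle k).trans_lt hx
    refine h1.trans ((key k).trans ?_)
    have h2 : (1 : ℝ) ≤ (e ^ (k + 1)) ^ 2 := by
      have h5 : 1 ≤ e := by linarith [Real.add_one_le_exp (1 : ℝ)]
      exact one_le_pow₀ (one_le_pow₀ h5)
    have h3 : (k : ℝ) + 1 ≤ ((k : ℝ) + 1) ^ N :=
      Real.self_le_rpow_of_one_le (by linarith [Nat.cast_nonneg (α := ℝ) k]) hN.le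
    have h4 : (k : ℝ) + 1 ≤ (e ^ (k + 1)) ^ 2 * ((k : ℝ) + 1) ^ N := by
      have : (0 : ℝ) < (k : ℝ) + 1 := by positivity
      nlinarith
    gcongr
  have h0 : μ {x | levelBound N * D < u x} = 0 :=
    (measureReal_eq_zero_iff (measure_ne_top _ _)).1 (le_antisymm hzero measureReal_nonneg)
  rw [ae_iff]
  simpa only [not_le] using h0

/-! ### Generalized inverses as measurable limits -/

section GeneralizedInverse

variable {n : ℕ}

/-- `ξ` minus the average of the first `m` iterates at `ξ` of `η ↦ η - c M η`. -/
noncomputable def rangeApprox (c : ℝ) (m : ℕ) (M : Matrix (Fin n) (Fin n) ℝ)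
    (ξ : EuclideanSpace ℝ (Fin n)) : EuclideanSpace ℝ (Fin n) :=
  ξ - birkhoffAverage ℝ (fun η => η - c • Matrix.toEuclideanCLM (𝕜 := ℝ) M η) _root_.id m ξ

/-- A linear section of `T` over its range, extended linearly to the whole space, is a generalized
inverse. -/
theorem ContinuousLinearMap.exists_comp_comp_eq_self {E : Type*} [NormedAddCommGroup E]
    [NormedSpace ℝ E] [FiniteDimensional ℝ E] (T : E →L[ℝ] E) :
    ∃ G : E →L[ℝ] E, ∀ ξ, T (G (T ξ)) = T ξ := by
  obtain ⟨g, hg⟩ := (T : E →ₗ[ℝ] E).rangeRestrict.exists_rightInverse_of_surjective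
    (T : E →ₗ[ℝ] E).range_rangeRestrict
  obtain ⟨G, hG⟩ := g.exists_extend
  refine ⟨LinearMap.toContinuousLinearMap G, fun ξ => ?_⟩
  have h1 := LinearMap.congr_fun hG ((T : E →ₗ[ℝ] E).rangeRestrict ξ)
  have h2 := LinearMap.congr_fun hg ((T : E →ₗ[ℝ] E).rangeRestrict ξ)
  have h3 : G (T ξ) = g ((T : E →ₗ[ℝ] E).rangeRestrict ξ) := h1
  have h4 := congrArg Subtype.val h2
  change T (G (T ξ)) = T ξ
  rw [h3]
  exact h4

/-- For small `c` the map `S = 1 - c M` is a contraction whose fixed points are the kernel of `M`.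
By the mean ergodic theorem its averages converge to the projection onto that kernel, so
`rangeApprox` converges to the complementary projection `P`. As `P ξ` depends on `ξ` only through `M
ξ`, it equals `Q (M ξ)` with `Q = P ∘ G`, `G` a generalized inverse of `M`. -/
theorem Matrix.PosSemidef.exists_tendsto_rangeApprox {M : Matrix (Fin n) (Fin n) ℝ}
    (hM : M.PosSemidef) {Λ : ℝ} (hΛ : ∀ i j, |M i j| ≤ Λ) {c : ℝ} (hc : 0 < c)
    (hcΛ : c * (n ^ 2 * Λ) ≤ 1) :
    ∃ Q : EuclideanSpace ℝ (Fin n) →L[ℝ] EuclideanSpace ℝ (Fin n), ∀ ξ,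
      Tendsto (fun m => rangeApprox c m M ξ) atTop
        (𝓝 (Q (Matrix.toEuclideanCLM (𝕜 := ℝ) M ξ))) ∧
      Matrix.toEuclideanCLM (𝕜 := ℝ) M (Q (Matrix.toEuclideanCLM (𝕜 := ℝ) M ξ)) =
        Matrix.toEuclideanCLM (𝕜 := ℝ) M ξ := by
  set T := Matrix.toEuclideanCLM (𝕜 := ℝ) M with hT
  set S : EuclideanSpace ℝ (Fin n) →L[ℝ] EuclideanSpace ℝ (Fin n) := 1 - c • T with hS
  have hSapp : ∀ ξ, S ξ = ξ - c • T ξ := fun ξ => rfl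
  have hS1 : ‖S‖ ≤ 1 := by
    refine ContinuousLinearMap.opNorm_le_bound _ zero_le_one fun ξ => ?_
    have h1 : ‖S ξ‖ ^ 2 ≤ ‖ξ‖ ^ 2 := by
      rw [hSapp, @norm_sub_sq_real, inner_smul_right, ← matForm_eq_inner, norm_smul,
        mul_pow, Real.norm_eq_abs, sq_abs]
      have h2 := hM.norm_sq_le hΛ ξ
      have h3 := hM.matForm_self_nonneg ξ
      -- In the expansion of `‖ξ - c M ξ‖ ^ 2`, half of the cross term already absorbs the quadratic
      -- term.
      have h4 : c ^ 2 * ‖T ξ‖ ^ 2 ≤ c * matForm M ξ ξ := by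
        calc c ^ 2 * ‖T ξ‖ ^ 2 ≤ c ^ 2 * (n ^ 2 * Λ * matForm M ξ ξ) := by gcongr
          _ = c * (c * (n ^ 2 * Λ)) * matForm M ξ ξ := by ring
          _ ≤ c * 1 * matForm M ξ ξ := by gcongr
          _ = _ := by ring
      have h5 : 0 ≤ c * matForm M ξ ξ := by positivity
      linarith
    rw [one_mul]
    exact le_of_sq_le_sq h1 (norm_nonneg _)
  set K := S.eqLocus (1 : EuclideanSpace ℝ (Fin n) →L[ℝ] EuclideanSpace ℝ (Fin n)) with hK
  have hmem : ∀ ξ, ξ ∈ K ↔ T ξ = 0 := fun ξ => by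
    rw [hK, LinearMap.mem_eqLocus]
    change S ξ = ξ ↔ _
    rw [hSapp, sub_eq_self, smul_eq_zero]
    simp [hc.ne']
  set P : EuclideanSpace ℝ (Fin n) →L[ℝ] EuclideanSpace ℝ (Fin n) :=
    1 - K.subtypeL ∘L K.orthogonalProjectionOnto with hP
  have hPapp : ∀ ξ, P ξ = ξ - (K.orthogonalProjectionOnto ξ : EuclideanSpace ℝ (Fin n)) :=
    fun ξ => rfl
  have hTP : ∀ ξ, T (P ξ) = T ξ := fun ξ => by
    rw [hPapp, map_sub, (hmem _).1 (K.orthogonalProjectionOnto ξ).2, sub_zero]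
  have hPK : ∀ ξ, T ξ = 0 → P ξ = 0 := fun ξ hξ => by
    rw [hPapp, K.orthogonalProjectionOnto_mem_subspace_eq_self ⟨ξ, (hmem ξ).2 hξ⟩, sub_self]
  obtain ⟨G, hG⟩ := T.exists_comp_comp_eq_self
  have hPG : ∀ ξ, P (G (T ξ)) = P ξ := fun ξ => by
    rw [← sub_eq_zero, ← map_sub]
    refine hPK _ ?_
    rw [map_sub, hG, sub_self]
  refine ⟨P ∘L G, fun ξ => ⟨?_, ?_⟩⟩
  · change Tendsto _ _ (𝓝 (P (G (T ξ))))
    rw [hPG, hPapp]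
    exact tendsto_const_nhds.sub (S.tendsto_birkhoffAverage_orthogonalProjection hS1 ξ)
  · change T (P (G (T ξ))) = _
    rw [hTP, hG]

variable {μ : Measure (EuclideanSpace ℝ (Fin n))}
  {A : EuclideanSpace ℝ (Fin n) → Matrix (Fin n) (Fin n) ℝ}

theorem IsCoefficientOn.aestronglyMeasurable_rangeApprox (hA : IsCoefficientOn μ A)
    {X : EuclideanSpace ℝ (Fin n) → EuclideanSpace ℝ (Fin n)} (hX : AEStronglyMeasurable X μ)
    (c : ℝ) (m : ℕ) : AEStronglyMeasurable (fun x => rangeApprox c m (A x) (X x)) μ := by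
  have h : ∀ k : ℕ, AEStronglyMeasurable (fun x =>
      (fun η => η - c • Matrix.toEuclideanCLM (𝕜 := ℝ) (A x) η)^[k] (X x)) μ := fun k => by
    induction k with
    | zero => simpa using hX
    | succ k ih =>
      simp only [Function.iterate_succ_apply']
      exact ih.sub ((hA.aestronglyMeasurable_toEuclideanCLM ih).const_smul c)
  exact hX.sub ((Finset.aestronglyMeasurable_fun_sum _ fun k _ => h k).const_smul ((m : ℝ)⁻¹))

end GeneralizedInverse

/-! ### Completeness -/

theorem exists_tendsto_eLpNorm_of_integral_sq_le {α F : Type*} [MeasurableSpace α] {μ : Measure α}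
    [NormedAddCommGroup F] [CompleteSpace F] {g : ℕ → α → F} (hg : ∀ k, MemLp (g k) 2 μ) {K : ℝ}
    (hK : 0 ≤ K) (h : ∀ N j k, N ≤ j → N ≤ k →
      ∫ x, ‖g j x - g k x‖ ^ 2 ∂μ ≤ K * ((1 / 2 : ℝ) ^ N) ^ 2) :
    ∃ G : α → F, MemLp G 2 μ ∧ Tendsto (fun k => eLpNorm (g k - G) 2 μ) atTop (𝓝 0) := by
  -- The completeness criterion asks for strict inequalities, hence `√K + 1` in place of `√K`.
  refine Lp.cauchy_complete_eLpNorm (B := fun N => ENNReal.ofReal ((√K + 1) * (1 / 2) ^ N))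
    (by norm_num) hg ?_ fun N j k hj hk => ?_
  · exact Summable.tsum_ofReal_ne_top
      ((summable_geometric_of_lt_one (by norm_num) (by norm_num)).mul_left _)
  · rw [((hg j).sub (hg k)).eLpNorm_eq_integral_rpow_norm (by norm_num) (by norm_num)]
    refine (ENNReal.ofReal_lt_ofReal_iff (by positivity)).2 ?_
    simp only [ENNReal.toReal_ofNat, Real.rpow_two, Pi.sub_apply]
    calc (∫ x, ‖g j x - g k x‖ ^ 2 ∂μ) ^ (2⁻¹ : ℝ)
        ≤ (K * ((1 / 2 : ℝ) ^ N) ^ 2) ^ (2⁻¹ : ℝ) :=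
          Real.rpow_le_rpow (integral_nonneg fun x => by positivity) (h N j k hj hk) (by norm_num)
      _ = √K * (1 / 2) ^ N := by
          rw [← one_div, ← Real.sqrt_eq_rpow, Real.sqrt_mul hK, Real.sqrt_sq (by positivity)]
      _ < (√K + 1) * (1 / 2) ^ N := by
          have : (0 : ℝ) < (1 / 2) ^ N := by positivity
          linarith

section Completeness

variable {n : ℕ} {μ : Measure (EuclideanSpace ℝ (Fin n))}
  {A : EuclideanSpace ℝ (Fin n) → Matrix (Fin n) (Fin n) ℝ}

theorem IsCoefficientOn.exists_norm_sq_le (hA : IsCoefficientOn μ A) :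
    ∃ K : ℝ, 0 ≤ K ∧ ∀ᵐ x ∂μ, ∀ ξ,
      ‖Matrix.toEuclideanCLM (𝕜 := ℝ) (A x) ξ‖ ^ 2 ≤ K * matForm (A x) ξ ξ := by
  obtain ⟨Λ, hΛ⟩ := hA.bounded
  refine ⟨n ^ 2 * |Λ|, by positivity, ?_⟩
  filter_upwards [hΛ, hA.posSemidef] with x h1 h2 ξ
  exact h2.norm_sq_le (fun i j => (h1 i j).trans (le_abs_self Λ)) ξ

/-- The fluxes `A X k` converge in `L²` to some `F`, and `U = Q F` with `Q` the pointwise inverse of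
`A` on its range. Fatou's lemma along an almost everywhere convergent subsequence bounds the energy
of `U - X N`. -/
theorem IsCoefficientOn.exists_lintegral_limit_le (hA : IsCoefficientOn μ A)
    {X : ℕ → EuclideanSpace ℝ (Fin n) → EuclideanSpace ℝ (Fin n)}
    (hX : ∀ k, FiniteEnergy μ A (X k))
    (h : ∀ N j k, N ≤ j → N ≤ k →
      energy μ A (fun x => X j x - X k x) (fun x => X j x - X k x) ≤ ((1 / 2 : ℝ) ^ N) ^ 2) :
    ∃ U : EuclideanSpace ℝ (Fin n) → EuclideanSpace ℝ (Fin n), AEStronglyMeasurable U μ ∧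
      ∀ N, ∫⁻ x, ENNReal.ofReal (matForm (A x) (U x - X N x) (U x - X N x)) ∂μ ≤
        ENNReal.ofReal (((1 / 2 : ℝ) ^ N) ^ 2) := by
  set T := fun x => Matrix.toEuclideanCLM (𝕜 := ℝ) (A x) with hT
  obtain ⟨K, hK0, hK⟩ := hA.exists_norm_sq_le
  have hflux : ∀ Y, FiniteEnergy μ A Y → Integrable (fun x => ‖T x (Y x)‖ ^ 2) μ := fun Y hY => by
    refine (hY.integrable_self.const_mul K).mono'
      ((hA.aestronglyMeasurable_toEuclideanCLM hY.meas).norm.pow 2) ?_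
    filter_upwards [hK] with x hx
    rw [Real.norm_of_nonneg (by positivity)]
    exact hx (Y x)
  have hL2 : ∀ k, MemLp (fun x => T x (X k x)) 2 μ := fun k =>
    (memLp_two_iff_integrable_sq_norm (hA.aestronglyMeasurable_toEuclideanCLM (hX k).meas)).2
      (hflux _ (hX k))
  obtain ⟨F, hF, hFlim⟩ := exists_tendsto_eLpNorm_of_integral_sq_le hL2 hK0
    fun N j k hj hk => by
      refine le_trans ?_ (mul_le_mul_of_nonneg_left (h N j k hj hk) hK0)
      rw [energy, ← integral_const_mul]
      have hd := (hX j).sub hA (hX k)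
      refine integral_mono_ae ?_ (hd.integrable_self.const_mul K) ?_
      · simpa only [map_sub] using hflux _ hd
      · filter_upwards [hK] with x hx
        rw [← map_sub]
        exact hx _
  obtain ⟨ns, hns, hae⟩ := (tendstoInMeasure_of_tendsto_eLpNorm (by norm_num)
    (fun k => (hL2 k).1) hF.1 hFlim).exists_seq_tendsto_ae
  obtain ⟨Λ, hΛ⟩ := hA.bounded
  set c : ℝ := (n ^ 2 * |Λ| + 1)⁻¹ with hc
  have hc0 : 0 < c := by positivity
  have hc1 : c * (n ^ 2 * |Λ|) ≤ 1 := by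
    rw [hc, inv_mul_le_one₀ (by positivity)]
    linarith
  -- `Q` is chosen point by point, with no measurability in `x`; that of `Q F` comes from the limits
  -- of `rangeApprox`.
  have hQ : ∀ x, ∃ Q : EuclideanSpace ℝ (Fin n) →L[ℝ] EuclideanSpace ℝ (Fin n),
      (A x).PosSemidef → (∀ i j, |A x i j| ≤ Λ) → ∀ ξ,
        Tendsto (fun m => rangeApprox c m (A x) ξ) atTop (𝓝 (Q (T x ξ))) ∧
        T x (Q (T x ξ)) = T x ξ := fun x => by
    by_cases hx : (A x).PosSemidef ∧ ∀ i j, |A x i j| ≤ Λ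
    · obtain ⟨Q, hQ⟩ := hx.1.exists_tendsto_rangeApprox
        (fun i j => (hx.2 i j).trans (le_abs_self Λ)) hc0 hc1
      exact ⟨Q, fun _ _ => hQ⟩
    · exact ⟨0, fun h1 h2 => absurd ⟨h1, h2⟩ hx⟩
  choose Q hQ using hQ
  have hlim : ∀ᵐ x ∂μ, Tendsto (fun k => Q x (T x (X (ns k) x))) atTop (𝓝 (Q x (F x))) := by
    filter_upwards [hae] with x hx
    exact ((Q x).continuous.tendsto _).comp hx
  have hmeas : ∀ k, AEStronglyMeasurable (fun x => Q x (T x (X (ns k) x))) μ := fun k => by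
    refine aestronglyMeasurable_of_tendsto_ae atTop
      (fun m => hA.aestronglyMeasurable_rangeApprox (hX (ns k)).meas c m) ?_
    filter_upwards [hΛ, hA.posSemidef] with x h1 h2
    exact (hQ x h2 h1 _).1
  refine ⟨fun x => Q x (F x), aestronglyMeasurable_of_tendsto_ae atTop hmeas hlim, fun N => ?_⟩
  have hcongr : ∀ᵐ x ∂μ, ENNReal.ofReal (matForm (A x) (Q x (F x) - X N x) (Q x (F x) - X N x)) =
      liminf (fun k => ENNReal.ofReal
        (matForm (A x) (X (ns k) x - X N x) (X (ns k) x - X N x))) atTop := by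
    filter_upwards [hΛ, hA.posSemidef, hlim] with x h1 h2 h3
    -- The energy of `ξ - η` sees `ξ` only through `A ξ`, so `X (ns k)` may be replaced by `Q A X
    -- (ns k)`, which does converge pointwise.
    have hker : ∀ ξ ξ' η, T x ξ = T x ξ' →
        matForm (A x) (ξ - η) (ξ - η) = matForm (A x) (ξ' - η) (ξ' - η) := fun ξ ξ' η hξ => by
      have h4 : T x (ξ - η) = T x (ξ' - η) := by rw [map_sub, map_sub, hξ]
      rw [matForm_eq_inner, h4, ← matForm_eq_inner, h2.matForm_comm, matForm_eq_inner, h4,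
        ← matForm_eq_inner]
    have h5 : ∀ k, matForm (A x) (X (ns k) x - X N x) (X (ns k) x - X N x) =
        matForm (A x) (Q x (T x (X (ns k) x)) - X N x) (Q x (T x (X (ns k) x)) - X N x) :=
      fun k => hker _ _ _ (hQ x h2 h1 _).2.symm
    simp only [h5]
    have h6 : Tendsto (fun k => Q x (T x (X (ns k) x)) - X N x) atTop
      (𝓝 (Q x (F x) - X N x)) := h3.sub_const _
    refine (Tendsto.liminf_eq ((ENNReal.continuous_ofReal.tendsto _).comp ?_)).symm
    simp only [matForm_eq_inner]
    exact h6.inner (((Matrix.toEuclideanCLM (𝕜 := ℝ) (A x)).continuous.tendsto _).comp h6)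
  rw [lintegral_congr_ae hcongr]
  have hd : ∀ k, FiniteEnergy μ A (fun x => X (ns k) x - X N x) := fun k =>
    (hX (ns k)).sub hA (hX N)
  refine (lintegral_liminf_le' fun k =>
    (hd k).integrable_self.aestronglyMeasurable.aemeasurable.ennreal_ofReal).trans ?_
  refine liminf_le_of_frequently_le' (Eventually.frequently ?_)
  filter_upwards [eventually_ge_atTop N] with k hk
  rw [lintegral_matForm_eq hA (hd k)]
  exact ENNReal.ofReal_le_ofReal (h N (ns k) N (hk.trans (hns.id_le k)) le_rfl)

end Completeness

/-! ### Lipschitz functions with compact support -/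

section Lipschitz

variable {n : ℕ} {B : Set (EuclideanSpace ℝ (Fin n))} {w v : EuclideanSpace ℝ (Fin n) → ℝ}
  {μ : Measure (EuclideanSpace ℝ (Fin n))}
  {A : EuclideanSpace ℝ (Fin n) → Matrix (Fin n) (Fin n) ℝ}

theorem measurable_gradient (w : EuclideanSpace ℝ (Fin n) → ℝ) : Measurable (gradient w) :=
  (InnerProductSpace.toDual ℝ (EuclideanSpace ℝ (Fin n))).symm.continuous.measurable.comp
    (measurable_fderiv ℝ w)

theorem LipschitzWith.norm_gradient_le {K : ℝ≥0} (h : LipschitzWith K w)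
    (x : EuclideanSpace ℝ (Fin n)) : ‖gradient w x‖ ≤ K := by
  rw [gradient, LinearIsometryEquiv.norm_map]
  exact norm_fderiv_le_of_lipschitz ℝ h

theorem IsLipZero.continuous (hw : IsLipZero B w) : Continuous w :=
  hw.lipschitz.choose_spec.continuous

theorem IsLipZero.memLp [IsFiniteMeasureOnCompacts μ] (hw : IsLipZero B w) (p : ℝ≥0∞) :
    MemLp w p μ :=
  hw.continuous.memLp_of_hasCompactSupport hw.compact

theorem IsLipZero.integrable [IsFiniteMeasureOnCompacts μ] (hw : IsLipZero B w) :
    Integrable w μ :=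
  hw.continuous.integrable_of_hasCompactSupport hw.compact

theorem IsLipZero.zero : IsLipZero B (fun _ => 0) where
  lipschitz := ⟨0, LipschitzWith.const 0⟩
  compact := HasCompactSupport.zero
  support := by simp [tsupport]

theorem IsLipZero.add (hw : IsLipZero B w) (hv : IsLipZero B v) :
    IsLipZero B (fun x => w x + v x) where
  lipschitz := by
    obtain ⟨K, hK⟩ := hw.lipschitz
    obtain ⟨L, hL⟩ := hv.lipschitz
    exact ⟨K + L, hK.add hL⟩
  compact := hw.compact.add hv.compact
  support := (closure_mono (Function.support_add w v)).trans <| by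
    rw [closure_union]
    exact union_subset hw.support hv.support

theorem IsLipZero.const_mul (hw : IsLipZero B w) (c : ℝ) : IsLipZero B (fun x => c * w x) where
  lipschitz := by
    obtain ⟨K, hK⟩ := hw.lipschitz
    refine ⟨‖c‖₊ * K, LipschitzWith.of_dist_le_mul fun x y => ?_⟩
    rw [Real.dist_eq, ← mul_sub, abs_mul, NNReal.coe_mul, mul_assoc, ← Real.dist_eq]
    exact mul_le_mul_of_nonneg_left (hK.dist_le_mul x y) (abs_nonneg c)
  compact := hw.compact.mono (Function.support_mul_subset_right _ _)
  support := (closure_mono (Function.support_mul_subset_right _ _)).trans hw.support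

theorem IsLipZero.sub (hw : IsLipZero B w) (hv : IsLipZero B v) :
    IsLipZero B (fun x => w x - v x) := by
  simpa [sub_eq_add_neg] using hw.add (hv.const_mul (-1))

theorem IsLipZero.posPart_sub (hw : IsLipZero B w) {l : ℝ} (hl : 0 ≤ l) :
    IsLipZero B (fun x => max (w x - l) 0) := by
  have hs : Function.support (fun x => max (w x - l) 0) ⊆ Function.support w := fun x hx h0 => by
    apply hx
    simp [h0, hl]
  refine ⟨?_, hw.compact.mono hs, (closure_mono hs).trans hw.support⟩
  obtain ⟨K, hK⟩ := hw.lipschitz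
  exact ⟨K + 0, (hK.sub (LipschitzWith.const l)).max_const 0⟩

theorem IsLipZero.ae_differentiableAt (hw : IsLipZero B w) (hμ : μ ≪ volume) :
    ∀ᵐ x ∂μ, DifferentiableAt ℝ w x :=
  hμ.ae_le hw.lipschitz.choose_spec.ae_differentiableAt

theorem IsLipZero.gradient_add (hw : IsLipZero B w) (hv : IsLipZero B v) (hμ : μ ≪ volume) :
    gradient (fun x => w x + v x) =ᵐ[μ] fun x => gradient w x + gradient v x := by
  filter_upwards [hw.ae_differentiableAt hμ, hv.ae_differentiableAt hμ] with x h1 h2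
  simp [gradient, fderiv_fun_add h1 h2]

theorem IsLipZero.gradient_sub (hw : IsLipZero B w) (hv : IsLipZero B v) (hμ : μ ≪ volume) :
    gradient (fun x => w x - v x) =ᵐ[μ] fun x => gradient w x - gradient v x := by
  filter_upwards [hw.ae_differentiableAt hμ, hv.ae_differentiableAt hμ] with x h1 h2
  simp [gradient, fderiv_fun_sub h1 h2]

theorem IsLipZero.gradient_const_mul (hw : IsLipZero B w) (c : ℝ) (hμ : μ ≪ volume) :
    gradient (fun x => c * w x) =ᵐ[μ] fun x => c • gradient w x := by
  filter_upwards [hw.ae_differentiableAt hμ] with x h1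
  simp [gradient, fderiv_const_mul h1]

/-- Where `w ≤ l` the truncation is at its minimum, so its gradient vanishes; where `w > l` it
agrees locally with `w - l`. Hence the identity holds at every point, even where `w` is not
differentiable. -/
theorem matForm_gradient_posPart_sub (M : Matrix (Fin n) (Fin n) ℝ) (hw : Continuous w) (l : ℝ)
    (x : EuclideanSpace ℝ (Fin n)) :
    matForm M (gradient w x) (gradient (fun x => max (w x - l) 0) x) =
      matForm M (gradient (fun x => max (w x - l) 0) x)
        (gradient (fun x => max (w x - l) 0) x) := by
  rcases le_or_gt (w x) l with h | h
  · have h1 : IsLocalMin (fun x => max (w x - l) 0) x := Eventually.of_forall fun y => by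
      simp only [max_eq_right (sub_nonpos.2 h)]
      exact le_max_right _ _
    have h2 : gradient (fun x => max (w x - l) 0) x = 0 := by
      simp [gradient, h1.fderiv_eq_zero]
    rw [h2]
    simp [matForm]
  · have h1 : (fun x => max (w x - l) 0) =ᶠ[𝓝 x] fun x => w x - l := by
      filter_upwards [hw.continuousAt.eventually (lt_mem_nhds h)] with y hy
      exact max_eq_left (sub_nonneg.2 hy.le)
    have h2 : gradient (fun x => max (w x - l) 0) x = gradient w x := by
      rw [gradient, gradient, h1.fderiv_eq, fderiv_sub_const]
    rw [h2]

theorem IsLipZero.finiteEnergy [IsFiniteMeasure μ] (hA : IsCoefficientOn μ A)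
    (hw : IsLipZero B w) : FiniteEnergy μ A (gradient w) := by
  have hm := (measurable_gradient w).aestronglyMeasurable (μ := μ)
  obtain ⟨K, hK⟩ := hw.lipschitz
  obtain ⟨Λ, hΛ⟩ := hA.bounded
  refine ⟨hm, Integrable.of_bound (hA.aestronglyMeasurable_matForm hm hm)
    (n ^ 2 * |Λ| * (K * K)) ?_⟩
  filter_upwards [hΛ] with x hx
  refine (abs_matForm_le (fun i j => (hx i j).trans (le_abs_self Λ)) _ _).trans ?_
  have := hK.norm_gradient_le x
  gcongr

end Lipschitz

/-! ### The space `(W_A^{1,2})_0(B)` through real integrals -/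

section Sobolev

variable {n : ℕ} {B : Set (EuclideanSpace ℝ (Fin n))}
  {A : EuclideanSpace ℝ (Fin n) → Matrix (Fin n) (Fin n) ℝ}
  {u v : EuclideanSpace ℝ (Fin n) → ℝ}
  {U V : EuclideanSpace ℝ (Fin n) → EuclideanSpace ℝ (Fin n)}

theorem normalizedMeasure_absolutelyContinuous (B : Set (EuclideanSpace ℝ (Fin n))) :
    normalizedMeasure B ≪ volume :=
  Measure.smul_absolutelyContinuous.trans Measure.restrict_le_self.absolutelyContinuous

theorem IsCoefficient.isCoefficientOn (hA : IsCoefficient B A) :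
    IsCoefficientOn (normalizedMeasure B) A := by
  have h : normalizedMeasure B ≪ volume.restrict B := Measure.smul_absolutelyContinuous
  obtain ⟨Λ, hΛ⟩ := hA.bounded
  exact ⟨fun i j => (hA.measurable i j).mono_ac h, ⟨Λ, h.ae_le hΛ⟩, h.ae_le hA.posSemidef⟩

theorem gradNorm_eq (hA : IsCoefficientOn (normalizedMeasure B) A)
    (hU : FiniteEnergy (normalizedMeasure B) A U) :
    gradNorm A B U = ENNReal.ofReal √(energy (normalizedMeasure B) A U U) := by
  rw [gradNorm, lintegral_matForm_eq hA hU,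
    ENNReal.ofReal_rpow_of_nonneg (energy_self_nonneg hA) (by norm_num), Real.sqrt_eq_rpow]

theorem lintegral_sobolev_eq (hA : IsCoefficientOn (normalizedMeasure B) A)
    (hu : MemLp u 2 (normalizedMeasure B)) (hU : FiniteEnergy (normalizedMeasure B) A U) :
    ∫⁻ x, (ENNReal.ofReal (u x ^ 2) + ENNReal.ofReal (matForm (A x) (U x) (U x)))
      ∂(normalizedMeasure B) =
    ENNReal.ofReal (∫ x, u x ^ 2 ∂(normalizedMeasure B) +
      energy (normalizedMeasure B) A U U) := by
  rw [lintegral_add_left' (hu.1.aemeasurable.pow_const 2).ennreal_ofReal,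
    lintegral_matForm_eq hA hU, ENNReal.ofReal_add (integral_nonneg fun x => sq_nonneg _)
    (energy_self_nonneg hA), ofReal_integral_eq_lintegral_ofReal hu.integrable_sq
    (ae_of_all _ fun x => sq_nonneg _)]

theorem tendsto_sobolevNorm_iff (hA : IsCoefficientOn (normalizedMeasure B) A)
    {u : ℕ → EuclideanSpace ℝ (Fin n) → ℝ}
    {U : ℕ → EuclideanSpace ℝ (Fin n) → EuclideanSpace ℝ (Fin n)}
    (hu : ∀ k, MemLp (u k) 2 (normalizedMeasure B))
    (hU : ∀ k, FiniteEnergy (normalizedMeasure B) A (U k)) :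
    Tendsto (fun k => sobolevNorm A B (u k) (U k)) atTop (𝓝 0) ↔
      Tendsto (fun k => ∫ x, u k x ^ 2 ∂(normalizedMeasure B)) atTop (𝓝 0) ∧
      Tendsto (fun k => energy (normalizedMeasure B) A (U k) (U k)) atTop (𝓝 0) := by
  have h0 : ∀ k, 0 ≤ ∫ x, u k x ^ 2 ∂(normalizedMeasure B) :=
    fun k => integral_nonneg fun x => sq_nonneg _
  have h1 : ∀ k, 0 ≤ energy (normalizedMeasure B) A (U k) (U k) := fun k => energy_self_nonneg hA
  have h2 : ∀ k, sobolevNorm A B (u k) (U k) = ENNReal.ofReal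
      (√(∫ x, u k x ^ 2 ∂(normalizedMeasure B) +
        energy (normalizedMeasure B) A (U k) (U k))) := fun k => by
    rw [sobolevNorm, lintegral_sobolev_eq hA (hu k) (hU k),
      ENNReal.ofReal_rpow_of_nonneg (add_nonneg (h0 k) (h1 k)) (by norm_num), Real.sqrt_eq_rpow]
  simp only [h2]
  constructor
  · intro h
    have h3 : Tendsto (fun k => ∫ x, u k x ^ 2 ∂(normalizedMeasure B) +
        energy (normalizedMeasure B) A (U k) (U k)) atTop (𝓝 0) := by
      have h4 := ((ENNReal.tendsto_toReal ENNReal.zero_ne_top).comp h).pow 2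
      simp only [ENNReal.toReal_zero, ne_eq, OfNat.ofNat_ne_zero, not_false_eq_true,
        zero_pow] at h4
      refine h4.congr fun k => ?_
      simp only [Function.comp_apply]
      rw [ENNReal.toReal_ofReal (Real.sqrt_nonneg _),
        Real.sq_sqrt (add_nonneg (h0 k) (h1 k))]
    exact ⟨squeeze_zero h0 (fun k => le_add_of_nonneg_right (h1 k)) h3,
      squeeze_zero h1 (fun k => le_add_of_nonneg_left (h0 k)) h3⟩
  · rintro ⟨h3, h4⟩
    have h5 := (ENNReal.continuous_ofReal.comp Real.continuous_sqrt).tendsto (0 + 0 : ℝ)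
    simpa [Function.comp_def] using h5.comp (h3.add h4)

theorem MemW0.of_tendsto [IsFiniteMeasure (normalizedMeasure B)]
    (hA : IsCoefficientOn (normalizedMeasure B) A) (hu : MemLp u 2 (normalizedMeasure B))
    (hU : FiniteEnergy (normalizedMeasure B) A U) {w : ℕ → EuclideanSpace ℝ (Fin n) → ℝ}
    (hw : ∀ k, IsLipZero B (w k))
    (h1 : Tendsto (fun k => ∫ x, (u x - w k x) ^ 2 ∂(normalizedMeasure B)) atTop (𝓝 0))
    (h2 : Tendsto (fun k => energy (normalizedMeasure B) A (fun x => U x - gradient (w k) x)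
      (fun x => U x - gradient (w k) x)) atTop (𝓝 0)) : MemW0 A B u U where
  meas := hu.1
  meas_grad := hU.meas
  approx := ⟨w, hw, (tendsto_sobolevNorm_iff hA (fun k => hu.sub ((hw k).memLp 2))
    (fun k => hU.sub hA ((hw k).finiteEnergy hA))).2 ⟨h1, h2⟩⟩

theorem MemW0.exists_tendsto [IsFiniteMeasure (normalizedMeasure B)]
    (hA : IsCoefficientOn (normalizedMeasure B) A) (h : MemW0 A B u U) :
    MemLp u 2 (normalizedMeasure B) ∧ FiniteEnergy (normalizedMeasure B) A U ∧
    ∃ w : ℕ → EuclideanSpace ℝ (Fin n) → ℝ, (∀ k, IsLipZero B (w k)) ∧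
      Tendsto (fun k => ∫ x, (u x - w k x) ^ 2 ∂(normalizedMeasure B)) atTop (𝓝 0) ∧
      Tendsto (fun k => energy (normalizedMeasure B) A (fun x => U x - gradient (w k) x)
        (fun x => U x - gradient (w k) x)) atTop (𝓝 0) := by
  obtain ⟨w, hw, hlim⟩ := h.approx
  have hwE := fun k => (hw k).finiteEnergy hA
  -- One approximant at finite distance suffices: adding it back gives `u` in `L²` and finite energy
  -- of `U`.
  obtain ⟨k, hk⟩ := (hlim.eventually (gt_mem_nhds ENNReal.zero_lt_top)).exists
  rw [sobolevNorm, ENNReal.rpow_lt_top_iff_of_pos (by norm_num)] at hk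
  have hum : AEStronglyMeasurable (fun x => u x - w k x) (normalizedMeasure B) :=
    h.meas.sub (hw k).continuous.aestronglyMeasurable
  have hd1 : MemLp (fun x => u x - w k x) 2 (normalizedMeasure B) := by
    rw [memLp_two_iff_integrable_sq hum]
    refine (lintegral_ofReal_ne_top_iff_integrable (hum.pow 2)
      (ae_of_all _ fun x => sq_nonneg _)).1 (ne_top_of_le_ne_top hk.ne ?_)
    exact lintegral_mono fun x => le_self_add
  have hd2 : FiniteEnergy (normalizedMeasure B) A (fun x => U x - gradient (w k) x) :=
    FiniteEnergy.of_lintegral hA (h.meas_grad.sub (hwE k).meas)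
      (ne_top_of_le_ne_top hk.ne (lintegral_mono fun x => le_add_self))
  have hu : MemLp u 2 (normalizedMeasure B) := by
    have := hd1.add ((hw k).memLp 2)
    refine this.ae_eq (ae_of_all _ fun x => ?_)
    simp
  have hU : FiniteEnergy (normalizedMeasure B) A U := by
    simpa using hd2.add hA (hwE k)
  exact ⟨hu, hU, w, hw, (tendsto_sobolevNorm_iff hA (fun k => hu.sub ((hw k).memLp 2))
    (fun k => hU.sub hA (hwE k))).1 hlim⟩

theorem IsLipZero.memW0 [IsFiniteMeasure (normalizedMeasure B)]
    (hA : IsCoefficientOn (normalizedMeasure B) A) {w : EuclideanSpace ℝ (Fin n) → ℝ}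
    (hw : IsLipZero B w) : MemW0 A B w (gradient w) :=
  MemW0.of_tendsto hA (hw.memLp 2) (hw.finiteEnergy hA) (fun _ => hw) (by simp)
    (by simp [energy, matForm])

theorem MemW0.sub [IsFiniteMeasure (normalizedMeasure B)]
    (hA : IsCoefficientOn (normalizedMeasure B) A) (hu : MemW0 A B u U) (hv : MemW0 A B v V) :
    MemW0 A B (fun x => u x - v x) (fun x => U x - V x) := by
  obtain ⟨hu2, hU, w, hw, hw1, hw2⟩ := hu.exists_tendsto hA
  obtain ⟨hv2, hV, z, hz, hz1, hz2⟩ := hv.exists_tendsto hA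
  refine MemW0.of_tendsto hA (hu2.sub hv2) (hU.sub hA hV) (fun k => (hw k).sub (hz k)) ?_ ?_
  · refine squeeze_zero (fun k => integral_nonneg fun x => sq_nonneg _) (fun k => ?_)
      (by simpa using (hw1.const_mul 2).add (hz1.const_mul 2))
    have i1 : Integrable (fun x => (u x - w k x) ^ 2) (normalizedMeasure B) :=
      (hu2.sub ((hw k).memLp 2)).integrable_sq
    have i2 : Integrable (fun x => (v x - z k x) ^ 2) (normalizedMeasure B) :=
      (hv2.sub ((hz k).memLp 2)).integrable_sq
    rw [← integral_const_mul, ← integral_const_mul,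
      ← integral_add (i1.const_mul 2) (i2.const_mul 2)]
    refine integral_mono_of_nonneg (ae_of_all _ fun x => sq_nonneg _)
      ((i1.const_mul 2).add (i2.const_mul 2)) (ae_of_all _ fun x => ?_)
    simp only
    nlinarith [sq_nonneg (u x - w k x + (v x - z k x))]
  · refine squeeze_zero (fun k => energy_self_nonneg hA) (fun k => ?_)
      (by simpa using (hw2.const_mul 2).add (hz2.const_mul 2))
    have e1 : (fun x => U x - V x - gradient (fun x => w k x - z k x) x)
        =ᵐ[normalizedMeasure B]
        fun x => (U x - gradient (w k) x) + (-1 : ℝ) • (V x - gradient (z k) x) := by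
      filter_upwards [(hw k).gradient_sub (hz k)
        (normalizedMeasure_absolutelyContinuous B)] with x hx
      rw [hx]
      simp only [neg_smul, one_smul]
      abel
    have f1 := hU.sub hA ((hw k).finiteEnergy hA)
    have f2 := hV.sub hA ((hz k).finiteEnergy hA)
    rw [energy_congr e1 e1]
    refine (energy_add_self_le hA f1 (f2.const_smul (-1))).trans (le_of_eq ?_)
    rw [energy_smul_left, energy_comm hA (X := fun x => V x - gradient (z k) x)
      (Y := fun x => (-1 : ℝ) • (V x - gradient (z k) x)), energy_smul_left]
    ring

end Sobolev

/-! ### Convergence of energies -/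

section Convergence

variable {n : ℕ} {μ : Measure (EuclideanSpace ℝ (Fin n))}
  {A : EuclideanSpace ℝ (Fin n) → Matrix (Fin n) (Fin n) ℝ}

theorem tendsto_energy_left (hA : IsCoefficientOn μ A)
    {U Y : EuclideanSpace ℝ (Fin n) → EuclideanSpace ℝ (Fin n)}
    {X : ℕ → EuclideanSpace ℝ (Fin n) → EuclideanSpace ℝ (Fin n)}
    (hU : FiniteEnergy μ A U) (hY : FiniteEnergy μ A Y) (hX : ∀ k, FiniteEnergy μ A (X k))
    (h : Tendsto (fun k => energy μ A (fun x => U x - X k x) (fun x => U x - X k x)) atTop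
      (𝓝 0)) :
    Tendsto (fun k => energy μ A (X k) Y) atTop (𝓝 (energy μ A U Y)) := by
  rw [tendsto_iff_norm_sub_tendsto_zero]
  have h1 := ((Real.continuous_sqrt.tendsto 0).comp h).mul_const √(energy μ A Y Y)
  simp only [Real.sqrt_zero, zero_mul] at h1
  refine squeeze_zero (fun _ => norm_nonneg _) (fun k => ?_) h1
  rw [norm_sub_rev, ← energy_sub_left hA hU (hX k) hY, Real.norm_eq_abs]
  exact abs_energy_le hA (hU.sub hA (hX k)) hY

/-- The variance of `|g|` is nonnegative. -/
theorem integral_abs_le_sqrt {α : Type*} [MeasurableSpace α] {μ : Measure α}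
    [IsProbabilityMeasure μ] {g : α → ℝ} (hg : MemLp g 2 μ) :
    ∫ x, |g x| ∂μ ≤ √(∫ x, g x ^ 2 ∂μ) := by
  refine Real.le_sqrt_of_sq_le ?_
  set m := ∫ x, |g x| ∂μ with hm
  have i1 : Integrable (fun x => |g x|) μ := (hg.integrable (by norm_num)).abs
  have h1 : 0 ≤ ∫ x, (|g x| - m) ^ 2 ∂μ := integral_nonneg fun x => sq_nonneg _
  have h2 : ∀ x, (|g x| - m) ^ 2 = g x ^ 2 - (2 * m * |g x| - m ^ 2) := fun x => by
    rw [sub_sq, sq_abs]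
    ring
  simp only [h2] at h1
  have i2 : Integrable (fun x => 2 * m * |g x| - m ^ 2) μ :=
    (i1.const_mul _).sub (integrable_const _)
  rw [integral_sub hg.integrable_sq i2,
    integral_sub (i1.const_mul _) (integrable_const _), integral_const_mul, ← hm] at h1
  simp at h1
  linarith

theorem tendsto_setIntegral_posPart_sub {α : Type*} [MeasurableSpace α] {μ : Measure α}
    [IsProbabilityMeasure μ] {u : α → ℝ} {w : ℕ → α → ℝ} (hu : MemLp u 2 μ)
    (hw : ∀ k, MemLp (w k) 2 μ) (h : Tendsto (fun k => ∫ x, (u x - w k x) ^ 2 ∂μ) atTop (𝓝 0))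
    (l : ℝ) (E : Set α) :
    Tendsto (fun k => ∫ x in E, max (w k x - l) 0 ∂μ) atTop
      (𝓝 (∫ x in E, max (u x - l) 0 ∂μ)) := by
  have hint : ∀ v : α → ℝ, MemLp v 2 μ → Integrable (fun x => max (v x - l) 0) μ :=
    fun v hv => ((hv.integrable (by norm_num)).sub (integrable_const l)).pos_part
  rw [tendsto_iff_norm_sub_tendsto_zero]
  have h1 := (Real.continuous_sqrt.tendsto 0).comp h
  rw [Real.sqrt_zero] at h1
  refine squeeze_zero (fun _ => norm_nonneg _) (fun k => ?_) h1
  have hd : Integrable (fun x => |u x - w k x|) μ :=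
    ((hu.sub (hw k)).integrable (by norm_num)).abs
  rw [norm_sub_rev, ← integral_sub (hint u hu).integrableOn (hint _ (hw k)).integrableOn]
  calc ‖∫ x in E, (max (u x - l) 0 - max (w k x - l) 0) ∂μ‖
      ≤ ∫ x in E, |u x - w k x| ∂μ := by
        refine norm_integral_le_of_norm_le hd.integrableOn (ae_of_all _ fun x => ?_)
        refine (abs_max_sub_max_le_abs _ _ _).trans (le_of_eq ?_)
        congr 1
        ring
    _ ≤ ∫ x, |u x - w k x| ∂μ :=
        setIntegral_le_integral hd (ae_of_all _ fun x => abs_nonneg _)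
    _ ≤ _ := integral_abs_le_sqrt (hu.sub (hw k))

end Convergence

/-! ### Weak solutions -/

section WeakSolution

variable {n : ℕ} {B : Set (EuclideanSpace ℝ (Fin n))}
  {A : EuclideanSpace ℝ (Fin n) → Matrix (Fin n) (Fin n) ℝ}
  {f g u v : EuclideanSpace ℝ (Fin n) → ℝ}
  {U V : EuclideanSpace ℝ (Fin n) → EuclideanSpace ℝ (Fin n)}

theorem IsLipZero.integrable_mul {μ : Measure (EuclideanSpace ℝ (Fin n))} [IsFiniteMeasure μ]
    {ψ : EuclideanSpace ℝ (Fin n) → ℝ} (hψ : IsLipZero B ψ) (hf : MemLp f ∞ μ) :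
    Integrable (fun x => f x * ψ x) μ :=
  (hf.mono_exponent le_top : MemLp f 2 μ).integrable_mul (hψ.memLp 2)

theorem isWeakSolution_zero [IsFiniteMeasure (normalizedMeasure B)]
    (hA : IsCoefficientOn (normalizedMeasure B) A) :
    IsWeakSolution A B (fun _ => 0) (fun _ => 0) (fun _ => 0) where
  mem := by
    have h := (IsLipZero.zero (B := B)).memW0 hA
    have h0 : gradient (fun _ : EuclideanSpace ℝ (Fin n) => (0 : ℝ)) = fun _ => 0 := by
      ext1 x
      exact gradient_fun_const x 0
    rwa [h0] at h
  eq ψ hψ := by simp [matForm]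

theorem IsWeakSolution.sub [IsFiniteMeasure (normalizedMeasure B)]
    (hA : IsCoefficientOn (normalizedMeasure B) A) (hf : MemLp f ∞ (normalizedMeasure B))
    (hg : MemLp g ∞ (normalizedMeasure B)) (hu : IsWeakSolution A B f u U)
    (hv : IsWeakSolution A B g v V) :
    IsWeakSolution A B (fun x => f x - g x) (fun x => u x - v x) (fun x => U x - V x) where
  mem := hu.mem.sub hA hv.mem
  eq ψ hψ := by
    have hU := (hu.mem.exists_tendsto hA).2.1
    have hV := (hv.mem.exists_tendsto hA).2.1
    have h1 := energy_sub_left hA hU hV (hψ.finiteEnergy hA)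
    have h2 : energy (normalizedMeasure B) A U (gradient ψ) = _ := hu.eq ψ hψ
    have h3 : energy (normalizedMeasure B) A V (gradient ψ) = _ := hv.eq ψ hψ
    rw [h2, h3] at h1
    simp only [sub_mul]
    rw [integral_sub (hψ.integrable_mul hf) (hψ.integrable_mul hg)]
    refine h1.trans ?_
    ring

/-- Testing with the approximants `w k` and passing to the limit gives `U` zero energy. Then `∇w k`
has the same energy as `U - ∇w k`, which tends to zero, and Poincaré forces `w k`, hence `u`, to
vanish in `L²`. -/
theorem IsWeakSolution.eq_zero [IsFiniteMeasure (normalizedMeasure B)]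
    (hA : IsCoefficientOn (normalizedMeasure B) A) {K : ℝ}
    (hpoinc : ∀ w, IsLipZero B w → ∫ x, w x ^ 2 ∂(normalizedMeasure B) ≤
      K * energy (normalizedMeasure B) A (gradient w) (gradient w))
    (hf : f =ᵐ[normalizedMeasure B] 0) (hu : IsWeakSolution A B f u U) :
    u =ᵐ[normalizedMeasure B] 0 ∧ energy (normalizedMeasure B) A U U = 0 := by
  obtain ⟨hu2, hU, w, hw, hw1, hw2⟩ := hu.mem.exists_tendsto hA
  have hE := fun k => (hw k).finiteEnergy hA
  have h0 : ∀ k, energy (normalizedMeasure B) A U (gradient (w k)) = 0 := fun k => by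
    refine (hu.eq _ (hw k)).trans ?_
    rw [integral_eq_zero_of_ae, neg_zero]
    filter_upwards [hf] with x hx
    simp [hx]
  have hUU : energy (normalizedMeasure B) A U U = 0 := by
    have h1 := tendsto_energy_left hA hU hU hE hw2
    refine tendsto_nhds_unique h1 ?_
    simp only [energy_comm hA (Y := U), h0]
    exact tendsto_const_nhds
  have h1 : ∀ k, energy (normalizedMeasure B) A (gradient (w k)) (gradient (w k)) =
      energy (normalizedMeasure B) A (fun x => U x - gradient (w k) x)
        (fun x => U x - gradient (w k) x) := fun k => by
    have hd := hU.sub hA (hE k)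
    rw [energy_sub_left hA hU (hE k) hd, energy_comm hA (X := U), energy_sub_left hA hU (hE k) hU,
      energy_comm hA (X := gradient (w k)) (Y := fun x => U x - gradient (w k) x),
      energy_sub_left hA hU (hE k) (hE k), energy_comm hA (X := gradient (w k)) (Y := U), h0, hUU]
    ring
  have h2 : ∫ x, u x ^ 2 ∂(normalizedMeasure B) ≤ 0 := by
    have hlim : Tendsto (fun k => 2 * ∫ x, (u x - w k x) ^ 2 ∂(normalizedMeasure B) +
        2 * (K * energy (normalizedMeasure B) A (fun x => U x - gradient (w k) x)
        (fun x => U x - gradient (w k) x))) atTop (𝓝 0) := by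
      simpa using (hw1.const_mul 2).add ((hw2.const_mul K).const_mul 2)
    refine ge_of_tendsto' hlim fun k => ?_
    have i1 : Integrable (fun x => (u x - w k x) ^ 2) (normalizedMeasure B) :=
      (hu2.sub ((hw k).memLp 2)).integrable_sq
    have i2 : Integrable (fun x => w k x ^ 2) (normalizedMeasure B) :=
      ((hw k).memLp 2).integrable_sq
    have h3 := hpoinc _ (hw k)
    rw [h1] at h3
    refine le_trans ?_ (add_le_add_right (mul_le_mul_of_nonneg_left h3 zero_le_two) _)
    rw [← integral_const_mul, ← integral_const_mul,
      ← integral_add (i1.const_mul 2) (i2.const_mul 2)]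
    refine integral_mono_of_nonneg (ae_of_all _ fun x => sq_nonneg _)
      ((i1.const_mul 2).add (i2.const_mul 2)) (ae_of_all _ fun x => ?_)
    simp only
    nlinarith [sq_nonneg (u x - w k x - w k x)]
  refine ⟨?_, hUU⟩
  have h3 := (integral_eq_zero_iff_of_nonneg (fun x => sq_nonneg (u x)) hu2.integrable_sq).1
    (le_antisymm h2 (integral_nonneg fun x => sq_nonneg _))
  filter_upwards [h3] with x hx
  simpa using hx

/-- Lipschitz functions with compact support in `B` as a vector space. -/
def lipZero (B : Set (EuclideanSpace ℝ (Fin n))) : Submodule ℝ (EuclideanSpace ℝ (Fin n) → ℝ) where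
  carrier := {w | IsLipZero B w}
  add_mem' := fun hw hv => IsLipZero.add hw hv
  zero_mem' := IsLipZero.zero
  smul_mem' := fun c _ hw => IsLipZero.const_mul hw c

/-- Riesz representation of `w ↦ -∫ f w` for the energy form. Poincaré makes the approximating
sequence Cauchy in `L²` as well, and the two limits form the pair `(u, U)`. -/
theorem exists_isWeakSolution [IsFiniteMeasure (normalizedMeasure B)]
    (hA : IsCoefficientOn (normalizedMeasure B) A) {K C : ℝ} (hK : 0 ≤ K)
    (hpoinc : ∀ w, IsLipZero B w → ∫ x, w x ^ 2 ∂(normalizedMeasure B) ≤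
      K * energy (normalizedMeasure B) A (gradient w) (gradient w))
    (hf : MemLp f ∞ (normalizedMeasure B))
    (hfC : ∀ w, IsLipZero B w → |∫ x, f x * w x ∂(normalizedMeasure B)| ≤
      C * √(energy (normalizedMeasure B) A (gradient w) (gradient w))) :
    ∃ u U, IsWeakSolution A B f u U := by
  set μ := normalizedMeasure B with hμ
  have hac : μ ≪ volume := normalizedMeasure_absolutelyContinuous B
  let c : PreInnerProductSpace.Core ℝ (lipZero B) :=
    { inner := fun w v => energy μ A (gradient w.1) (gradient v.1)
      conj_inner_symm := fun w v => energy_comm hA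
      re_inner_nonneg := fun w => energy_self_nonneg hA
      add_left := fun w v z => by
        have hw : IsLipZero B w.1 := w.2
        have hv : IsLipZero B v.1 := v.2
        have hz : IsLipZero B z.1 := z.2
        refine (energy_congr (hw.gradient_add hv hac) EventuallyEq.rfl).trans ?_
        exact energy_add_left hA (hw.finiteEnergy hA) (hv.finiteEnergy hA) (hz.finiteEnergy hA)
      smul_left := fun w v r => by
        have hw : IsLipZero B w.1 := w.2
        refine (energy_congr (hw.gradient_const_mul r hac) EventuallyEq.rfl).trans ?_
        exact energy_smul_left r }
  let ℓ : lipZero B →ₗ[ℝ] ℝ :=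
    { toFun := fun w => -∫ x, f x * w.1 x ∂μ
      map_add' := fun w v => by
        have hw : IsLipZero B w.1 := w.2
        have hv : IsLipZero B v.1 := v.2
        have h := integral_add (hw.integrable_mul hf) (hv.integrable_mul hf)
        simp only [← mul_add] at h
        rw [← neg_add, ← h]
        rfl
      map_smul' := fun r w => by
        have h := integral_const_mul (μ := μ) r (fun x => f x * w.1 x)
        simp only [RingHom.id_apply, smul_eq_mul, mul_neg, ← h]
        congr 2
        ext x
        change f x * (r * w.1 x) = r * (f x * w.1 x)
        ring }
  obtain ⟨w, hcau, hlim⟩ := exists_seq_tendsto_of_abs_le c ℓ C fun v => by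
    have := hfC v.1 v.2
    rwa [← abs_neg] at this
  have hw : ∀ k, IsLipZero B (w k).1 := fun k => (w k).2
  have hE := fun k => (hw k).finiteEnergy hA
  have hsub : ∀ j k, energy μ A (gradient (fun x => (w j).1 x - (w k).1 x))
      (gradient (fun x => (w j).1 x - (w k).1 x)) =
      energy μ A (fun x => gradient (w j).1 x - gradient (w k).1 x)
        (fun x => gradient (w j).1 x - gradient (w k).1 x) := fun j k =>
    energy_congr ((hw j).gradient_sub (hw k) hac) ((hw j).gradient_sub (hw k) hac)
  have hcau' : ∀ N j k, N ≤ j → N ≤ k →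
      energy μ A (gradient (fun x => (w j).1 x - (w k).1 x))
        (gradient (fun x => (w j).1 x - (w k).1 x)) ≤ ((1 / 2 : ℝ) ^ N) ^ 2 := hcau
  obtain ⟨U, hUm, hUlim⟩ := hA.exists_lintegral_limit_le hE fun N j k hj hk => by
    rw [← hsub]
    exact hcau' N j k hj hk
  obtain ⟨u, hu, hulim⟩ := exists_tendsto_eLpNorm_of_integral_sq_le
    (fun k => (hw k).memLp (μ := μ) 2) hK fun N j k hj hk => by
      simp only [Real.norm_eq_abs, sq_abs]
      exact (hpoinc _ ((hw j).sub (hw k))).trans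
        (mul_le_mul_of_nonneg_left (hcau' N j k hj hk) hK)
  have hUd : ∀ k, FiniteEnergy μ A (fun x => U x - gradient (w k).1 x) := fun k =>
    FiniteEnergy.of_lintegral hA (hUm.sub (hE k).meas)
      (ne_top_of_le_ne_top ENNReal.ofReal_ne_top (hUlim k))
  have hU : FiniteEnergy μ A U := by simpa using (hUd 0).add hA (hE 0)
  have hU0 : Tendsto (fun k => energy μ A (fun x => U x - gradient (w k).1 x)
      (fun x => U x - gradient (w k).1 x)) atTop (𝓝 0) := by
    have h1 : Tendsto (fun k : ℕ => ((1 / 2 : ℝ) ^ k) ^ 2) atTop (𝓝 0) := by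
      simpa using (tendsto_pow_atTop_nhds_zero_of_lt_one (by norm_num : (0 : ℝ) ≤ 1 / 2)
        (by norm_num)).pow 2
    refine squeeze_zero (fun k => energy_self_nonneg hA) (fun k => ?_) h1
    have h2 := hUlim k
    rwa [lintegral_matForm_eq hA (hUd k), ENNReal.ofReal_le_ofReal_iff (by positivity)] at h2
  have hu0 : Tendsto (fun k => ∫ x, (u x - (w k).1 x) ^ 2 ∂μ) atTop (𝓝 0) := by
    have h1 := ((ENNReal.tendsto_toReal ENNReal.zero_ne_top).comp hulim).pow 2
    simp only [ENNReal.toReal_zero, ne_eq, OfNat.ofNat_ne_zero, not_false_eq_true,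
      zero_pow] at h1
    refine h1.congr fun k => ?_
    have h2 : 0 ≤ ∫ x, (u x - (w k).1 x) ^ 2 ∂μ := integral_nonneg fun x => sq_nonneg _
    simp only [Function.comp_apply]
    rw [eLpNorm_sub_comm, (hu.sub ((hw k).memLp 2)).eLpNorm_eq_integral_rpow_norm (by norm_num)
      (by norm_num)]
    simp only [ENNReal.toReal_ofNat, Real.rpow_two, Pi.sub_apply, Real.norm_eq_abs, sq_abs]
    rw [ENNReal.toReal_ofReal (by positivity), ← one_div, ← Real.sqrt_eq_rpow, Real.sq_sqrt h2]
  refine ⟨u, U, MemW0.of_tendsto hA hu hU hw hu0 hU0, fun ψ hψ => ?_⟩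
  exact tendsto_nhds_unique (tendsto_energy_left hA hU (hψ.finiteEnergy hA) hE hU0)
    (hlim ⟨ψ, hψ⟩)

/-- The energy estimate for truncations, combined with the Sobolev inequality. -/
theorem IsWeakSolution.integral_posPart_sub_le [IsProbabilityMeasure (normalizedMeasure B)]
    (hA : IsCoefficientOn (normalizedMeasure B) A) (hu : IsWeakSolution A B f u U) {M : ℝ}
    (hf : MemLp f ∞ (normalizedMeasure B)) (hfM : ∀ᵐ x ∂(normalizedMeasure B), |f x| ≤ M)
    {l b : ℝ} (hl : 0 ≤ l) (hb : 0 ≤ b)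
    (hsob : ∀ ψ, IsLipZero B ψ → ∫ x in {x | l < u x}, |ψ x| ∂(normalizedMeasure B) ≤
      b * √(energy (normalizedMeasure B) A (gradient ψ) (gradient ψ))) :
    ∫ x, max (u x - l) 0 ∂(normalizedMeasure B) ≤ b ^ 2 * M := by
  set μ := normalizedMeasure B with hμ
  obtain ⟨hu2, hU, w, hw, hw1, hw2⟩ := hu.mem.exists_tendsto hA
  have hM : 0 ≤ M := by
    obtain ⟨x, hx⟩ := hfM.exists
    exact (abs_nonneg _).trans hx
  set ψ : ℕ → EuclideanSpace ℝ (Fin n) → ℝ := fun k x => max (w k x - l) 0 with hψ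
  have hψL : ∀ k, IsLipZero B (ψ k) := fun k => (hw k).posPart_sub hl
  set ε : ℕ → ℝ := fun k => √(energy μ A (fun x => U x - gradient (w k) x)
    (fun x => U x - gradient (w k) x)) with hε
  set q : ℕ → ℝ := fun k => √(energy μ A (gradient (ψ k)) (gradient (ψ k))) with hq
  set c : ℕ → ℝ := fun k => ∫ x, ψ k x ∂μ with hc
  set F := ∫ x, max (u x - l) 0 ∂μ with hF
  have hF0 : 0 ≤ F := integral_nonneg fun x => le_max_right _ _
  -- The approximants are truncated rather than `u` itself, so that the test functions are
  -- Lipschitz; `ε k * q k` is the cost of replacing `U` by `∇w k`.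
  have hq2 : ∀ k, q k ^ 2 ≤ M * c k + ε k * q k := fun k => by
    have hwE := (hw k).finiteEnergy hA
    have hψE := (hψL k).finiteEnergy hA
    have h1 : q k ^ 2 = energy μ A (gradient (w k)) (gradient (ψ k)) := by
      rw [hq, Real.sq_sqrt (energy_self_nonneg hA)]
      exact integral_congr_ae (ae_of_all _ fun x =>
        (matForm_gradient_posPart_sub (A x) (hw k).continuous l x).symm)
    have h2 := energy_sub_left hA hU hwE hψE
    have h3 : energy μ A U (gradient (ψ k)) = -∫ x, f x * ψ k x ∂μ := hu.eq _ (hψL k)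
    have h4 := neg_le_of_abs_le (abs_energy_le hA (hU.sub hA hwE) hψE)
    have h5 : -∫ x, f x * ψ k x ∂μ ≤ M * c k := by
      rw [← integral_neg, hc, ← integral_const_mul]
      refine integral_mono_ae ((hψL k).integrable_mul hf).neg
        ((hψL k).integrable.const_mul M) ?_
      filter_upwards [hfM] with x hx
      have h6 : 0 ≤ ψ k x := le_max_right _ _
      have h7 := neg_le_of_abs_le hx
      nlinarith
    change -(ε k * q k) ≤ _ at h4
    linarith
  have hql : ∀ k, q k ≤ ε k + √(M * c k) := fun k => by
    have hc0 : 0 ≤ c k := integral_nonneg fun x => le_max_right _ _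
    have h1 := Real.sq_sqrt (mul_nonneg hM hc0)
    have h2 : 0 ≤ ε k := Real.sqrt_nonneg _
    have h3 := Real.sqrt_nonneg (M * c k)
    by_contra! h
    nlinarith [hq2 k]
  have hclim : Tendsto c atTop (𝓝 F) := by
    have := tendsto_setIntegral_posPart_sub hu2 (fun k => (hw k).memLp 2) hw1 l univ
    simpa only [setIntegral_univ] using this
  have hεlim : Tendsto ε atTop (𝓝 0) := by
    have := (Real.continuous_sqrt.tendsto 0).comp hw2
    rwa [Real.sqrt_zero] at this
  -- The Sobolev bound is used on the fixed set `{u > l}`, not on `{w k > l}`; nothing is lost in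
  -- the limit because `(u - l)⁺` vanishes off it.
  have hElim := tendsto_setIntegral_posPart_sub hu2 (fun k => (hw k).memLp 2) hw1 l {x | l < u x}
  have hFE : ∫ x in {x | l < u x}, max (u x - l) 0 ∂μ = F := by
    refine setIntegral_eq_integral_of_forall_compl_eq_zero fun x hx => ?_
    have : u x ≤ l := not_lt.1 hx
    simpa using this
  rw [hFE] at hElim
  -- Squaring `F ≤ b √(M F)` and cancelling one factor `F` gives the claim.
  have hmain : F ≤ b * (0 + √(M * F)) := by
    refine le_of_tendsto_of_tendsto' hElim ((hεlim.add
      ((Real.continuous_sqrt.tendsto _).comp (hclim.const_mul M))).const_mul b) fun k => ?_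
    have h1 := hsob _ (hψL k)
    refine le_trans (le_of_eq ?_) (h1.trans (mul_le_mul_of_nonneg_left (hql k) hb))
    refine integral_congr_ae (ae_of_all _ fun x => ?_)
    exact (abs_of_nonneg (le_max_right _ _)).symm
  rw [zero_add] at hmain
  rcases hF0.eq_or_lt with h | h
  · rw [← h]
    positivity
  · have h1 : F ^ 2 ≤ (b * √(M * F)) ^ 2 := by gcongr
    rw [mul_pow, Real.sq_sqrt (by positivity)] at h1
    refine le_of_mul_le_mul_right ?_ h
    linarith

end WeakSolution

/-! ### The theorem -/

theorem IsMetricBall.nonempty {X : Type*} {B : Set X} (hB : IsMetricBall B) : B.Nonempty := by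
  obtain ⟨d, x, r, hr, rfl⟩ := hB
  exact ⟨x, @Metric.mem_ball_self X d.toPseudoMetricSpace x r hr⟩

theorem isProbabilityMeasure_normalizedMeasure {n : ℕ} {B : Set (EuclideanSpace ℝ (Fin n))}
    (hne : B.Nonempty) (hopen : IsOpen B) (hbdd : Bornology.IsBounded B) :
    IsProbabilityMeasure (normalizedMeasure B) :=
  -- The normalized measure is by definition the conditional measure of `volume` given `B`.
  ProbabilityTheory.cond_isProbabilityMeasure_of_finite (hopen.measure_pos volume hne).ne'
    hbdd.measure_lt_top.ne

/-- One-sided boundedness of weak solutions. -/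
theorem IsWeakSolution.ae_le {n : ℕ} {B : Set (EuclideanSpace ℝ (Fin n))}
    {A : EuclideanSpace ℝ (Fin n) → Matrix (Fin n) (Fin n) ℝ}
    [IsProbabilityMeasure (normalizedMeasure B)]
    (hA : IsCoefficientOn (normalizedMeasure B) A) {N C : ℝ} (hN : 1 < N) (hC : 0 ≤ C)
    (hsob : ∀ w, IsLipZero B w → ∀ s, Real.exp 1 ≤ s → ∀ E : Set (EuclideanSpace ℝ (Fin n)),
      ∫ x in E, |w x| ∂(normalizedMeasure B) ≤
        (s * (normalizedMeasure B).real E + 1 / (s * Real.log s ^ N)) *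
          (C * √(energy (normalizedMeasure B) A (gradient w) (gradient w))))
    {f u : EuclideanSpace ℝ (Fin n) → ℝ}
    {U : EuclideanSpace ℝ (Fin n) → EuclideanSpace ℝ (Fin n)} (hu : IsWeakSolution A B f u U)
    (hf : MemLp f ∞ (normalizedMeasure B)) {M : ℝ} (hM : 0 < M)
    (hfM : ∀ᵐ x ∂(normalizedMeasure B), |f x| ≤ M) :
    ∀ᵐ x ∂(normalizedMeasure B), u x ≤ levelBound N * ((C ^ 2 + 1) * M) := by
  -- Here `D = (C ^ 2 + 1) * M` rather than `C ^ 2 * M`, since `D` must be positive and `C` may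
  -- vanish.
  refine ae_le_of_superlevel_estimate ((hu.mem.exists_tendsto hA).1.integrable (by norm_num)) hN
    (by positivity) fun l hl s hs => ?_
  have hs1 : 1 ≤ s := le_trans (by simp) hs
  have hlog : 0 ≤ Real.log s := Real.log_nonneg hs1
  have h := hu.integral_posPart_sub_le hA hf hfM hl
    (b := (s * (normalizedMeasure B).real {x | l < u x} + 1 / (s * Real.log s ^ N)) * C)
    (by positivity) fun ψ hψ => by
      rw [mul_assoc]
      exact hsob ψ hψ s hs _
  refine h.trans ?_
  rw [mul_pow, mul_assoc]
  gcongr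
  linarith

theorem theorem1 {n : ℕ} (B : Set (EuclideanSpace ℝ (Fin n)))
    (hball : IsMetricBall B) (hopen : IsOpen B) (hbdd : Bornology.IsBounded B)
    (A : EuclideanSpace ℝ (Fin n) → Matrix (Fin n) (Fin n) ℝ) (hA : IsCoefficient B A)
    (φ : ℝ → ℝ≥0∞) (hφ : IsYoungFunction φ) (N : ℝ) (hN : 1 < N)
    (hφ_sq : ∀ t : ℝ, 0 ≤ t → ENNReal.ofReal (t ^ 2) ≤ φ t)
    (hφ_log : ∀ t : ℝ, 1 ≤ t → ENNReal.ofReal (t ^ 2 * Real.log t ^ N) ≤ φ t)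
    (C₀ : ℝ≥0)
    (hsobolev : ∀ (w : EuclideanSpace ℝ (Fin n) → ℝ)
      (W : EuclideanSpace ℝ (Fin n) → EuclideanSpace ℝ (Fin n)), MemW0 A B w W →
        luxemburgNorm φ (normalizedMeasure B) w ≤ C₀ * gradNorm A B W) :
    ∃ C : ℝ≥0, ∀ f : EuclideanSpace ℝ (Fin n) → ℝ, MemLp f ∞ (normalizedMeasure B) →
      ∃ (u : EuclideanSpace ℝ (Fin n) → ℝ)
        (U : EuclideanSpace ℝ (Fin n) → EuclideanSpace ℝ (Fin n)),
        IsWeakSolution A B f u U ∧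
        (∀ (v : EuclideanSpace ℝ (Fin n) → ℝ)
          (V : EuclideanSpace ℝ (Fin n) → EuclideanSpace ℝ (Fin n)),
          IsWeakSolution A B f v V →
            v =ᵐ[normalizedMeasure B] u ∧ gradNorm A B (fun x => V x - U x) = 0) ∧
        eLpNorm u ∞ (normalizedMeasure B) ≤ C * eLpNorm f ∞ (normalizedMeasure B) := by
  have := isProbabilityMeasure_normalizedMeasure hball.nonempty hopen hbdd
  have hA' := hA.isCoefficientOn
  set μ := normalizedMeasure B with hμ
  have hlux : ∀ w, IsLipZero B w → luxemburgNorm φ μ w ≤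
      ENNReal.ofReal (C₀ * √(energy μ A (gradient w) (gradient w))) := fun w hw => by
    have h := hsobolev w (gradient w) (hw.memW0 hA')
    rwa [gradNorm_eq hA' (hw.finiteEnergy hA'), ← ENNReal.ofReal_coe_nnreal,
      ← ENNReal.ofReal_mul C₀.coe_nonneg] at h
  have hκ : ∀ w : EuclideanSpace ℝ (Fin n) → ℝ,
      0 ≤ C₀ * √(energy μ A (gradient w) (gradient w)) := fun w => by positivity
  have hsob : ∀ w, IsLipZero B w → ∀ s, Real.exp 1 ≤ s → ∀ E : Set (EuclideanSpace ℝ (Fin n)),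
      ∫ x in E, |w x| ∂μ ≤ (s * μ.real E + 1 / (s * Real.log s ^ N)) *
        (C₀ * √(energy μ A (gradient w) (gradient w))) := fun w hw s hs E =>
    setIntegral_abs_le_of_luxemburgNorm_le hφ.even hφ_log (by linarith) hw.integrable (hκ w)
      (hlux w hw) hs E
  have hpoinc : ∀ w, IsLipZero B w →
      ∫ x, w x ^ 2 ∂μ ≤ (C₀ : ℝ) ^ 2 * energy μ A (gradient w) (gradient w) := fun w hw => by
    have h := lintegral_sq_le_of_luxemburgNorm_le hφ.even hφ_sq (hκ w) (hlux w hw)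
    rw [← ofReal_integral_eq_lintegral_ofReal (hw.memLp 2).integrable_sq
      (ae_of_all _ fun x => sq_nonneg _), ENNReal.ofReal_le_ofReal_iff (by positivity), mul_pow,
      Real.sq_sqrt (energy_self_nonneg hA')] at h
    exact h
  have hbd : ∀ f : EuclideanSpace ℝ (Fin n) → ℝ, MemLp f ∞ μ → ∀ᵐ x ∂μ, |f x| ≤
      (eLpNorm f ∞ μ).toReal := fun f hf => by
    filter_upwards [ae_le_eLpNormEssSup (f := f) (μ := μ)] with x hx
    rw [← eLpNorm_exponent_top] at hx
    have := ENNReal.toReal_mono hf.2.ne hx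
    simpa using this
  set C : ℝ≥0 := Real.toNNReal (levelBound N * ((C₀ : ℝ) ^ 2 + 1)) with hC
  have hCr : (C : ℝ) = levelBound N * ((C₀ : ℝ) ^ 2 + 1) :=
    Real.coe_toNNReal _ (mul_nonneg (levelBound_nonneg N) (by positivity))
  refine ⟨C, fun f hf => ?_⟩
  set m := (eLpNorm f ∞ μ).toReal with hm
  have hm0 : 0 ≤ m := ENNReal.toReal_nonneg
  have hfm := hbd f hf
  -- The bound on the functional is the `L¹` estimate with `s = e` on the whole space.
  obtain ⟨u, U, hu⟩ := exists_isWeakSolution hA' (K := (C₀ : ℝ) ^ 2)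
    (C := m * ((Real.exp 1 * μ.real univ + 1 / (Real.exp 1 * Real.log (Real.exp 1) ^ N)) * C₀))
    (by positivity) hpoinc hf fun w hw => by
      calc |∫ x, f x * w x ∂μ| ≤ ∫ x, m * |w x| ∂μ := by
            refine (Real.norm_eq_abs _).ge.trans
              (norm_integral_le_of_norm_le ((hw.integrable (μ := μ)).abs.const_mul m) ?_)
            filter_upwards [hfm] with x hx
            rw [Real.norm_eq_abs, abs_mul]
            gcongr
        _ ≤ _ := by
            have h := hsob w hw (Real.exp 1) le_rfl univ
            rw [setIntegral_univ] at h
            rw [integral_const_mul, mul_assoc, mul_assoc]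
            exact mul_le_mul_of_nonneg_left h hm0
  refine ⟨u, U, hu, fun v V hv => ?_, ?_⟩
  · obtain ⟨h1, h2⟩ := (hv.sub hA' hf hf hu).eq_zero hA' hpoinc
      (ae_of_all _ fun x => sub_self _)
    refine ⟨?_, ?_⟩
    · filter_upwards [h1] with x hx
      exact sub_eq_zero.1 hx
    · rw [gradNorm_eq hA' ((hv.sub hA' hf hf hu).mem.exists_tendsto hA').2.1, h2]
      simp
  -- The iteration needs a positive bound on `|f|`, and `m` may be zero; so `M > m` decreases to `m`
  -- at the end.
  · have key : ∀ M, m < M → eLpNorm u ∞ μ ≤ ENNReal.ofReal (C * M) := fun M hM => by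
      have hM0 : 0 < M := hm0.trans_lt hM
      have hfM : ∀ᵐ x ∂μ, |f x| ≤ M := hfm.mono fun x hx => hx.trans hM.le
      have h1 := hu.ae_le hA' hN C₀.coe_nonneg hsob hf hM0 hfM
      have h0 : MemLp (fun _ : EuclideanSpace ℝ (Fin n) => (0 : ℝ)) ∞ μ := MemLp.zero
      -- `-u`, as the zero solution minus `u`, solves the equation for `-f`; this gives the lower
      -- bound.
      have hneg := (isWeakSolution_zero hA').sub hA' h0 hf hu
      have h2 := hneg.ae_le hA' hN C₀.coe_nonneg hsob (h0.sub hf) hM0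
        (by simpa only [zero_sub, abs_neg] using hfM)
      rw [eLpNorm_exponent_top]
      refine eLpNormEssSup_le_of_ae_bound ?_
      filter_upwards [h1, h2] with x hx1 hx2
      rw [hCr, Real.norm_eq_abs, abs_le, mul_assoc]
      constructor <;> linarith
    have hlim : Tendsto (fun M : ℝ => ENNReal.ofReal (C * M)) (𝓝[>] m)
        (𝓝 (ENNReal.ofReal (C * m))) :=
      ((ENNReal.continuous_ofReal.comp (continuous_const_mul (C : ℝ))).tendsto m).mono_left
        nhdsWithin_le_nhds
    refine (ge_of_tendsto hlim (by
      filter_upwards [self_mem_nhdsWithin] with M hM using key M hM)).trans (le_of_eq ?_)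
    rw [ENNReal.ofReal_mul C.coe_nonneg, ENNReal.ofReal_coe_nnreal, ENNReal.ofReal_toReal hf.2.ne]
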